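/- Let $L$ be a number of qubits, and let $g_2,\dots,g_L$ be independent, mutually commuting Hermitian Pauli operators on $L$ qubits (Pauli strings with a sign $\pm1$) generating a stabilizer group $\mathcal G=\langle g_2,\dots,g_L\rangle$ with $-\mathbb 1\notin\mathcal G$. Let $\bar X,\bar Z$ be Hermitian Pauli operators that commute with every $g_j$ and anticommute with each other, and put $\bar Y=i\bar X\bar Z$; thus $\bar X,\bar Y,\bar Z$ are logical operators of the $[[L,1]]$ stabilizer code with stabilizer group $\mathcal G$. Let $|\psi\rangle$ be a pure $L$-qubit state with one unit of magic encoded in this code, that is, a unit vector with $$\rho=|\psi\rangle\langle\psi|=\frac1{2^L}\Big(\mathbb 1+\frac{\bar Z-\bar Y}{\sqrt2}\Big)\prod_{j=2}^L(\mathbb 1+g_j).$$ For an operator $\sigma$ on a set of qubits let $$\tilde{\mathcal M}_2(\sigma)=-\log_2\frac{\sum_P\operatorname{Tr}[P\sigma]^4}{\sum_P\operatorname{Tr}[P\sigma]^2},$$ where $P$ runs over all Pauli strings with phase $+1$ on these qubits. A logical operator $\bar\sigma$ is called reducible to a set $A$ of qubits if there is $s\in\mathcal G$ such that $\bar\sigma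 s$ acts as the identity outside $A$. Let $A\subseteq\{1,\dots,L\}$ be any set of qubits, $B$ its complement, and $\rho_A=\operatorname{Tr}_B\rho$. Then the following three conditions are equivalent. (a) $\tilde{\mathcal M}_2(\rho_A)=\log_2(4/3)$. (b) All three logical operators $\bar X,\bar Y,\bar Z$ are reducible to $A$. (c) Magic is unitarily extractable from $A$: for an ancilla qubit $C$ in the state $|0\rangle$, there are a Clifford unitary $U_{AC}$ acting only on $A$ and $C$ and a pure stabilizer state $|\psi'\rangle$ of the $L$ qubits $AB$ such that $$(\mathbb 1_B\otimes U_{AC})\,|\psi\rangle\otimes|0\rangle_C=|\psi'\rangle_{AB}\otimes|T\rangle_C,\qquad |T\rangle=\frac{|0\rangle+e^{i\pi/4}|1\rangle}{\sqrt2}.$$ -/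

import Mathlib

open scoped Matrix

noncomputable section

namespace QubitMagic

/-- Operators on a register whose qubits are labelled by `κ`; the computational basis consists of
the bit strings `κ → Fin 2`. -/
abbrev Op (κ : Type*) := Matrix (κ → Fin 2) (κ → Fin 2) ℂ

/-- The matrices `1, X, Y, Z`, in this order. -/
def pauliMat : Fin 4 → Matrix (Fin 2) (Fin 2) ℂ :=
  ![1, !![0, 1; 1, 0], !![0, -Complex.I; Complex.I, 0], !![1, 0; 0, -1]]

variable {κ : Type*} [Fintype κ] [DecidableEq κ]

/-- The Pauli string with phase `+1`: the tensor product over all qubits `i` of the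
matrices `pauliMat (p i)`. -/
def pauliString (p : κ → Fin 4) : Op κ :=
  Matrix.of fun x y => ∏ i, pauliMat (p i) (x i) (y i)

/-- Membership in the Pauli group: a Pauli string times a power of the imaginary unit. -/
def IsPauli (M : Op κ) : Prop :=
  ∃ (k : ℕ) (p : κ → Fin 4), M = Complex.I ^ k • pauliString p

/-- The Hermitian elements of the Pauli group: Pauli strings with a sign. -/
def IsHermitianPauli (M : Op κ) : Prop :=
  ∃ p : κ → Fin 4, M = pauliString p ∨ M = -pauliString p

/-- A Pauli operator that acts as the identity on every qubit outside `A`. -/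
def IsPauliSupportedOn (A : Finset κ) (M : Op κ) : Prop :=
  ∃ (k : ℕ) (p : κ → Fin 4), (∀ i, i ∉ A → p i = 0) ∧ M = Complex.I ^ k • pauliString p

/-- Clifford unitaries: conjugation maps the Pauli group to itself. -/
def IsClifford (U : Op κ) : Prop :=
  U ∈ Matrix.unitaryGroup (κ → Fin 2) ℂ ∧ ∀ M : Op κ, IsPauli M → IsPauli (U * M * Uᴴ)

/-- The operator `U ⊗ 1` that acts as `U` on the qubits in `S` and trivially on all others. -/
def localOp (S : Finset κ) (U : Op S) : Op κ :=
  Matrix.of fun x y => if ∀ i, i ∉ S → x i = y i then U (fun i => x i) (fun i => y i) else 0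

/-- The bit string that is `x` on `S` and `z` outside `S`. -/
def glue (S : Finset κ) (x : S → Fin 2) (z : {i // i ∉ S} → Fin 2) : κ → Fin 2 :=
  fun i => if h : i ∈ S then x ⟨i, h⟩ else z ⟨i, h⟩

/-- The reduced operator on `S`: the partial trace over the qubits outside `S`. -/
def reduced (S : Finset κ) (ρ : Op κ) : Op S :=
  Matrix.of fun x y => ∑ z : {i // i ∉ S} → Fin 2, ρ (glue S x z) (glue S y z)

/-- The density operator `|ψ⟩⟨ψ|`. -/
def density (ψ : (κ → Fin 2) → ℂ) : Op κ := Matrix.vecMulVec ψ (star ψ)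

/-- The (normalized) stabilizer 2-Rényi entropy
`-log₂ (∑_P Tr[Pρ]^4 / ∑_P Tr[Pρ]^2)`, the sums running over all Pauli strings with phase `+1`.
The traces are real for Hermitian `ρ`. -/
def stabilizerEntropy (ρ : Op κ) : ℝ :=
  -Real.logb 2 ((∑ p : κ → Fin 4, (Matrix.trace (pauliString p * ρ)).re ^ 4) /
    (∑ p : κ → Fin 4, (Matrix.trace (pauliString p * ρ)).re ^ 2))

/-- The product `∏ j, (1 + g j)` (in increasing order of `j`; the factors commute in all uses). -/
def stabProd {m : ℕ} (g : Fin m → Op κ) : Op κ := (List.ofFn fun j => 1 + g j).prod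

/-- Pure stabilizer states: unit vectors `φ` with `|φ⟩⟨φ| = ∏ j, (1 + s j) / 2` for `n` commuting
Hermitian Pauli operators `s j`, where `n` is the number of qubits. (The right-hand side has
trace one only if the `s j` are independent and do not generate `-1`.) -/
def IsStabilizerState (φ : (κ → Fin 2) → ℂ) : Prop :=
  star φ ⬝ᵥ φ = 1 ∧
  ∃ s : Fin (Fintype.card κ) → Op κ,
    (∀ j, IsHermitianPauli (s j)) ∧ (∀ i j, Commute (s i) (s j)) ∧
    density φ = ((2 : ℂ) ^ Fintype.card κ)⁻¹ • stabProd s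

/-- An `[[L, 1]]` stabilizer code with a choice of generators and of logical operators. -/
structure Code (L : ℕ) where
  /-- the stabilizer generators -/
  gen : Fin (L - 1) → Op (Fin L)
  /-- the logical operator `X̄` -/
  logX : Op (Fin L)
  /-- the logical operator `Z̄` -/
  logZ : Op (Fin L)
  gen_pauli : ∀ j, IsHermitianPauli (gen j)
  gen_commute : ∀ i j, Commute (gen i) (gen j)
  /-- the generators are independent -/
  gen_indep : ∀ j, gen j ∉ Submonoid.closure (gen '' {i | i ≠ j})
  neg_one_notMem : -1 ∉ Submonoid.closure (Set.range gen)
  logX_pauli : IsHermitianPauli logX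
  logZ_pauli : IsHermitianPauli logZ
  logX_commute : ∀ j, Commute logX (gen j)
  logZ_commute : ∀ j, Commute logZ (gen j)
  anticomm : logX * logZ = -(logZ * logX)

namespace Code

variable {L : ℕ}

/-- The logical operator `Ȳ = i X̄ Z̄`. -/
def logY (K : Code L) : Op (Fin L) := Complex.I • (K.logX * K.logZ)

/-- The stabilizer group. The generators square to `1`, so the monoid that they generate
is a group. -/
def stabGroup (K : Code L) : Submonoid (Op (Fin L)) := Submonoid.closure (Set.range K.gen)

/-- A logical operator is reducible to `A` if multiplication by some stabilizer makes it
supported on `A`. -/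
def Reducible (K : Code L) (A : Finset (Fin L)) (M : Op (Fin L)) : Prop :=
  ∃ s ∈ K.stabGroup, IsPauliSupportedOn A (M * s)

/-- The unit vector `ψ` is a state with one unit of magic encoded in the code:
`|ψ⟩⟨ψ| = 2^{-L} (1 + (Z̄ - Ȳ)/√2) ∏ j, (1 + g j)`. -/
def IsOneUnitState (K : Code L) (ψ : (Fin L → Fin 2) → ℂ) : Prop :=
  star ψ ⬝ᵥ ψ = 1 ∧
  density ψ = ((2 : ℂ) ^ L)⁻¹ •
    ((1 + ((Real.sqrt 2 : ℝ) : ℂ)⁻¹ • (K.logZ - K.logY)) * stabProd K.gen)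

end Code

/-- `|0⟩` -/
def ketZero : Fin 2 → ℂ := ![1, 0]

/-- The magic state `|T⟩ = (|0⟩ + e^{iπ/4} |1⟩)/√2`. -/
def ketT : Fin 2 → ℂ :=
  ((Real.sqrt 2 : ℝ) : ℂ)⁻¹ • ![1, Complex.exp (Complex.I * Real.pi / 4)]

/-- The state `ψ ⊗ χ` of the `L` qubits `some i` together with the ancilla qubit `none`. -/
def withAncilla {L : ℕ} (ψ : (Fin L → Fin 2) → ℂ) (χ : Fin 2 → ℂ) :
    (Option (Fin L) → Fin 2) → ℂ :=
  fun x => ψ (fun i => x (some i)) * χ (x none)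

/-- Magic is unitarily extractable from `A`: a Clifford unitary on the qubits of `A` and on an
ancilla in `|0⟩` produces `|T⟩` on the ancilla and leaves a stabilizer state on the `L` qubits. -/
def UnitarilyExtractable {L : ℕ} (A : Finset (Fin L)) (ψ : (Fin L → Fin 2) → ℂ) : Prop :=
  ∃ U : Op (Finset.insertNone A), IsClifford U ∧
    ∃ φ : (Fin L → Fin 2) → ℂ, IsStabilizerState φ ∧
      localOp (Finset.insertNone A) U *ᵥ withAncilla ψ ketZero = withAncilla φ ketT

end QubitMagic

end

/-! Everything is read off from the Pauli expectation values of `ψ` on strings supported in `A`. The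
state is a combination of Pauli operators in the cosets 𝒢, Z̄𝒢 and Ȳ𝒢, so these values have square 1
on 𝒢, 1/2 on Z̄𝒢 and Ȳ𝒢, and 0 elsewhere (`inCoset_of_expVal_ne_zero`, `InCoset.sq_expVal`).
Condition (a) says that 4 times the fourth moment is 3 times the second, that is, n₁ = (n_Z + n_Y)/2
for the numbers of strings on `A` in the three cosets. Translation gives n_Z, n_Y ≤ n₁
(`card_inCoset_le`), and n₁ > 0, so neither coset can be missing. Then X̄ is reducible as a product
of Ȳ and Z̄, which gives (b).

For (b) ⇒ (c), take anticommuting representatives a of Z̄ and b of -Ȳ on `A`. The operators u = a ⊗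
X and v = b ⊗ Y commute, and their controlled-sign gate (1 + u + v - uv)/2 is Clifford. Conjugation
by it sends a to X and b to Y on the ancilla, and the ancilla's Z to c = -i ab, while fixing the
generators. Thus the factor 1 + (a + b)/√2 becomes the projector on |T⟩ up to a scalar, and c
completes the generators to those of a stabilizer state.

For (c) ⇒ (a), a Clifford on `A` and the ancilla permutes Pauli strings up to sign and so preserves
even moments. These are multiplicative on product states. Second and fourth moments agree for
stabilizer states, while |T⟩ contributes 2 and 3/2. -/

open scoped Matrix

noncomputable section

namespace QubitMagic

set_option linter.unusedSectionVars false

variable {κ : Type*} [Fintype κ] [DecidableEq κ]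

/-! ### Algebra of Pauli strings -/

/-- The tensor product of one-qubit matrices. -/
def tensor (M : κ → Matrix (Fin 2) (Fin 2) ℂ) : Op κ :=
  Matrix.of fun x y => ∏ i, M i (x i) (y i)

theorem pauliString_eq_tensor (p : κ → Fin 4) : pauliString p = tensor fun i => pauliMat (p i) := rfl

theorem tensor_mul (M N : κ → Matrix (Fin 2) (Fin 2) ℂ) :
    tensor M * tensor N = tensor fun i => M i * N i := by
  ext x y
  simp only [tensor, Matrix.mul_apply, Matrix.of_apply, ← Finset.prod_mul_distrib]
  rw [Finset.prod_univ_sum, Fintype.piFinset_univ]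

theorem trace_tensor (M : κ → Matrix (Fin 2) (Fin 2) ℂ) :
    (tensor M).trace = ∏ i, (M i).trace := by
  simp only [tensor, Matrix.trace, Matrix.diag_apply, Matrix.of_apply]
  rw [Finset.prod_univ_sum, Fintype.piFinset_univ]

theorem tensor_one : tensor (fun _ : κ => 1) = 1 := by
  ext x y
  simp only [tensor, Matrix.of_apply, Matrix.one_apply, Finset.prod_ite_zero, Finset.mem_univ,
    forall_const, Finset.prod_const_one, funext_iff]

theorem tensor_smul (c : κ → ℂ) (M : κ → Matrix (Fin 2) (Fin 2) ℂ) :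
    tensor (fun i => c i • M i) = (∏ i, c i) • tensor M := by
  ext x y
  simp [tensor, Finset.prod_mul_distrib]

theorem tensor_conjTranspose (M : κ → Matrix (Fin 2) (Fin 2) ℂ) :
    (tensor M)ᴴ = tensor fun i => (M i)ᴴ := by
  ext x y
  simp [tensor, Matrix.conjTranspose_apply]

theorem fin4_xor_eq (a b : Fin 4) : a ^^^ b =
    (![![0, 1, 2, 3], ![1, 0, 3, 2], ![2, 3, 0, 1], ![3, 2, 1, 0]] : Fin 4 → Fin 4 → Fin 4) a b := by
  revert a b; decide

/-- In the order 1, X, Y, Z the Klein four-group law is bitwise xor of labels (XY = iZ and 1 xor 2 =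
3). The phases that occur are 1, i and -i, hence the exponents 0, 1, 3. -/
theorem pauliMat_mul (a b : Fin 4) :
    ∃ k : ℕ, pauliMat a * pauliMat b = Complex.I ^ k • pauliMat (a ^^^ b) := by
  rw [fin4_xor_eq]
  fin_cases a <;> fin_cases b
  all_goals
    first
    | refine ⟨0, ?_⟩; ext i j; fin_cases i <;> fin_cases j <;>
        simp [pauliMat, Matrix.mul_apply, Fin.sum_univ_two]
      done
    | refine ⟨1, ?_⟩; ext i j; fin_cases i <;> fin_cases j <;>
        simp [pauliMat, Matrix.mul_apply, Fin.sum_univ_two]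
      done
    | refine ⟨3, ?_⟩; ext i j; fin_cases i <;> fin_cases j <;>
        simp [pauliMat, Matrix.mul_apply, Fin.sum_univ_two]

theorem pauliMat_mul_self (a : Fin 4) : pauliMat a * pauliMat a = 1 := by
  fin_cases a <;> ext i j <;> fin_cases i <;> fin_cases j <;>
    simp [pauliMat, Matrix.mul_apply, Fin.sum_univ_two]

theorem pauliMat_conjTranspose (a : Fin 4) : (pauliMat a)ᴴ = pauliMat a := by
  fin_cases a <;> ext i j <;> fin_cases i <;> fin_cases j <;> simp [pauliMat]

theorem trace_pauliMat (a : Fin 4) : (pauliMat a).trace = if a = 0 then 2 else 0 := by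
  fin_cases a <;> simp [pauliMat, Matrix.trace, Fin.sum_univ_two]

theorem fin4_xor_eq_zero (a b : Fin 4) : a ^^^ b = 0 ↔ a = b := by
  revert a b; decide

theorem fin4_xor_right_injective (a b c : Fin 4) (h : a ^^^ c = b ^^^ c) : a = b := by
  revert a b c; decide

/-- The entrywise product of Pauli strings, up to phases. -/
def xorString (p q : κ → Fin 4) : κ → Fin 4 := fun i => p i ^^^ q i

theorem pauliString_mul (p q : κ → Fin 4) :
    ∃ k : ℕ, pauliString p * pauliString q = Complex.I ^ k • pauliString (xorString p q) := by
  choose k hk using fun i => pauliMat_mul (p i) (q i)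
  refine ⟨∑ i, k i, ?_⟩
  rw [pauliString_eq_tensor, pauliString_eq_tensor, tensor_mul, funext hk, tensor_smul,
    Finset.prod_pow_eq_pow_sum]
  rfl

theorem pauliString_mul_self (p : κ → Fin 4) : pauliString p * pauliString p = 1 := by
  rw [pauliString_eq_tensor, tensor_mul, ← tensor_one]
  simp only [pauliMat_mul_self]

theorem pauliString_conjTranspose (p : κ → Fin 4) : (pauliString p)ᴴ = pauliString p := by
  rw [pauliString_eq_tensor, tensor_conjTranspose]
  simp only [pauliMat_conjTranspose]

theorem pauliString_zero : pauliString (0 : κ → Fin 4) = 1 := by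
  rw [← tensor_one]; rfl

/-- At a qubit where the labels differ, the product is a traceless Pauli matrix, and the trace
factorizes over qubits. -/
theorem trace_pauliString_mul_of_ne {p q : κ → Fin 4} (h : p ≠ q) :
    (pauliString p * pauliString q).trace = 0 := by
  obtain ⟨k, hk⟩ := pauliString_mul p q
  obtain ⟨i, hi⟩ := Function.ne_iff.1 h
  rw [hk, Matrix.trace_smul, pauliString_eq_tensor, trace_tensor,
    Finset.prod_eq_zero (Finset.mem_univ i), smul_zero]
  rw [trace_pauliMat, if_neg]
  exact fun h => hi ((fin4_xor_eq_zero _ _).1 h)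

theorem pauliString_ne_zero (p : κ → Fin 4) : pauliString p ≠ 0 := by
  intro h
  have := pauliString_mul_self p
  rw [h, mul_zero] at this
  exact one_ne_zero this.symm

theorem eq_of_pauliString_eq_smul {p q : κ → Fin 4} {c : ℂ}
    (h : pauliString p = c • pauliString q) : p = q := by
  by_contra hne
  have h1 := trace_pauliString_mul_of_ne hne
  have h2 : c • (1 : Op κ) = pauliString p * pauliString q := by
    rw [h, smul_mul_assoc, pauliString_mul_self]
  have hc : c ≠ 0 := by
    rintro rfl
    exact pauliString_ne_zero p (by simpa using h)
  rw [← h2, Matrix.trace_smul, Matrix.trace_one] at h1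
  simp [hc] at h1

theorem I_pow_cases (k : ℕ) : Complex.I ^ k = 1 ∨ Complex.I ^ k = Complex.I ∨
    Complex.I ^ k = -1 ∨ Complex.I ^ k = -Complex.I := by
  induction k with
  | zero => simp
  | succ k ih =>
    rw [pow_succ]
    rcases ih with h | h | h | h <;> simp [h]

theorem IsPauli.mul {M N : Op κ} (hM : IsPauli M) (hN : IsPauli N) : IsPauli (M * N) := by
  obtain ⟨k, p, rfl⟩ := hM
  obtain ⟨l, q, rfl⟩ := hN
  obtain ⟨m, hm⟩ := pauliString_mul p q
  refine ⟨k + l + m, xorString p q, ?_⟩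
  rw [smul_mul_smul_comm, hm, smul_smul, pow_add, pow_add]

theorem IsPauli.I_pow_smul {M : Op κ} (hM : IsPauli M) (l : ℕ) :
    IsPauli (Complex.I ^ l • M) := by
  obtain ⟨k, p, rfl⟩ := hM
  exact ⟨l + k, p, by rw [smul_smul, pow_add]⟩

theorem IsPauli.neg {M : Op κ} (hM : IsPauli M) : IsPauli (-M) := by
  have := hM.I_pow_smul 2
  rwa [Complex.I_sq, neg_one_smul] at this

theorem isPauli_pauliString (p : κ → Fin 4) : IsPauli (pauliString p) := ⟨0, p, by simp⟩

theorem isPauli_one : IsPauli (1 : Op κ) := ⟨0, 0, by simp [pauliString_zero]⟩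

theorem IsHermitianPauli.isPauli {M : Op κ} (hM : IsHermitianPauli M) : IsPauli M := by
  obtain ⟨p, rfl | rfl⟩ := hM
  · exact isPauli_pauliString p
  · exact (isPauli_pauliString p).neg

theorem IsHermitianPauli.mul_self {M : Op κ} (hM : IsHermitianPauli M) : M * M = 1 := by
  obtain ⟨p, rfl | rfl⟩ := hM <;> simp [pauliString_mul_self]

theorem IsHermitianPauli.conjTranspose_eq {M : Op κ} (hM : IsHermitianPauli M) : Mᴴ = M := by
  obtain ⟨p, rfl | rfl⟩ := hM <;> simp [pauliString_conjTranspose]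

theorem IsPauli.isHermitianPauli {M : Op κ} (hM : IsPauli M) (h : Mᴴ = M) :
    IsHermitianPauli M := by
  obtain ⟨k, p, rfl⟩ := hM
  rw [Matrix.conjTranspose_smul, pauliString_conjTranspose] at h
  have h' : star (Complex.I ^ k) = Complex.I ^ k :=
    smul_left_injective ℂ (pauliString_ne_zero p) h
  rcases I_pow_cases k with hk | hk | hk | hk
  · exact ⟨p, Or.inl (by simp [hk])⟩
  · rw [hk] at h'
    simp [Complex.ext_iff] at h'
    norm_num at h'
  · exact ⟨p, Or.inr (by simp [hk])⟩
  · rw [hk] at h'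
    simp [Complex.ext_iff] at h'
    norm_num at h'

theorem IsPauli.mul_self {M : Op κ} (hM : IsPauli M) (h : Mᴴ = M) : M * M = 1 :=
  (hM.isHermitianPauli h).mul_self

/-- Taking adjoints reverses the product and conjugates its phase, and conjugation fixes or negates
a power of i. -/
theorem pauliString_commute_or_anticommute (p q : κ → Fin 4) :
    pauliString p * pauliString q = pauliString q * pauliString p ∨
      pauliString p * pauliString q = -(pauliString q * pauliString p) := by
  obtain ⟨k, hk⟩ := pauliString_mul p q
  have h1 : pauliString q * pauliString p =
      star (Complex.I ^ k) • pauliString (xorString p q) := by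
    have := congrArg Matrix.conjTranspose hk
    simpa only [Matrix.conjTranspose_mul, Matrix.conjTranspose_smul,
      pauliString_conjTranspose] using this
  rw [hk, h1]
  rcases I_pow_cases k with hk | hk | hk | hk <;> simp [hk]

theorem IsPauli.commute_or_anticommute {M N : Op κ} (hM : IsPauli M) (hN : IsPauli N) :
    M * N = N * M ∨ M * N = -(N * M) := by
  obtain ⟨k, p, rfl⟩ := hM
  obtain ⟨l, q, rfl⟩ := hN
  rw [smul_mul_smul_comm, smul_mul_smul_comm, mul_comm (Complex.I ^ l)]
  rcases pauliString_commute_or_anticommute p q with h | h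
  · left; rw [h]
  · right; rw [h, smul_neg]

/-! ### Local operators and the partial trace -/

/-- The partition of a register into the qubits of `S` and the others. -/
def splitEquiv (S : Finset κ) :
    (κ → Fin 2) ≃ (S → Fin 2) × ({i // i ∉ S} → Fin 2) :=
  Equiv.piEquivPiSubtypeProd (· ∈ S) fun _ => Fin 2

theorem localOp_eq_submatrix (S : Finset κ) (U : Op S) :
    localOp S U = (Matrix.kroneckerMap (· * ·) U
      (1 : Matrix ({i // i ∉ S} → Fin 2) ({i // i ∉ S} → Fin 2) ℂ)).submatrix
        (splitEquiv S) (splitEquiv S) := by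
  ext x y
  simp only [localOp, Matrix.of_apply, Matrix.submatrix_apply, Matrix.kroneckerMap_apply,
    Matrix.one_apply, splitEquiv, Equiv.piEquivPiSubtypeProd, Equiv.coe_fn_mk, funext_iff,
    Subtype.forall, mul_ite, mul_one, mul_zero]

/-- `localOp` as a homomorphism of algebras. -/
def localHom (S : Finset κ) : Op S →ₐ[ℂ] Op κ :=
  AlgHom.ofLinearMap
    { toFun := localOp S
      map_add' := fun U V => by
        ext x y
        simp only [localOp, Matrix.of_apply, Matrix.add_apply]
        split_ifs <;> simp
      map_smul' := fun c U => by
        ext x y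
        simp [localOp] }
    (by
      simp only [LinearMap.coe_mk, AddHom.coe_mk, localOp_eq_submatrix]
      rw [Matrix.kroneckerMap_one_one _ (by simp) (by simp) (by simp)]
      simp)
    (fun U V => by
      simp only [LinearMap.coe_mk, AddHom.coe_mk, localOp_eq_submatrix]
      rw [Matrix.submatrix_mul_equiv, ← Matrix.mul_kronecker_mul, mul_one])

theorem localHom_apply (S : Finset κ) (U : Op S) : localHom S U = localOp S U := rfl

theorem localOp_conjTranspose (S : Finset κ) (U : Op S) : localOp S Uᴴ = (localOp S U)ᴴ := by
  ext x y
  simp only [localOp, Matrix.of_apply, Matrix.conjTranspose_apply, eq_comm]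
  split_ifs <;> simp

/-- The extension of a Pauli string by identities. -/
def extString (S : Finset κ) (p : S → Fin 4) : κ → Fin 4 :=
  fun i => if h : i ∈ S then p ⟨i, h⟩ else 0

theorem localOp_pauliString (S : Finset κ) (p : S → Fin 4) :
    localOp S (pauliString p) = pauliString (extString S p) := by
  ext x y
  simp only [localOp, pauliString, Matrix.of_apply]
  rw [← Finset.prod_mul_prod_compl S]
  have h1 : ∏ i ∈ S, pauliMat (extString S p i) (x i) (y i) =
      ∏ i : S, pauliMat (p i) (x i) (y i) := by
    rw [← Finset.prod_coe_sort]
    exact Finset.prod_congr rfl fun i _ => by simp [extString]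
  have h2 : ∏ i ∈ Sᶜ, pauliMat (extString S p i) (x i) (y i) =
      if ∀ i, i ∉ S → x i = y i then 1 else 0 := by
    have : ∀ i ∈ Sᶜ, pauliMat (extString S p i) (x i) (y i) =
        if x i = y i then 1 else 0 := by
      intro i hi
      simp [extString, Finset.mem_compl.1 hi, pauliMat, Matrix.one_apply]
    simp only [Finset.prod_congr rfl this, Finset.prod_ite_zero, Finset.mem_compl,
      Finset.prod_const_one]
  rw [h1, h2]
  split_ifs <;> simp

/-- The partial trace is adjoint to tensoring with the identity. This replaces the reduced state by
expectation values in the global state. -/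
theorem trace_mul_reduced (S : Finset κ) (M : Op S) (ρ : Op κ) :
    (M * reduced S ρ).trace = (localOp S M * ρ).trace := by
  rw [localOp_eq_submatrix]
  have h : ρ = (ρ.submatrix (splitEquiv S).symm (splitEquiv S).symm).submatrix
      (splitEquiv S) (splitEquiv S) := by ext; simp
  rw [h, Matrix.submatrix_mul_equiv, ← h]
  simp only [Matrix.trace, Matrix.diag_apply, Matrix.submatrix_apply]
  rw [Equiv.sum_comp (splitEquiv S) (fun z => (_ * _ : Matrix _ _ ℂ) z z), Fintype.sum_prod_type]
  refine Finset.sum_congr rfl fun x _ => ?_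
  simp only [Matrix.mul_apply, reduced, Matrix.of_apply, Finset.mul_sum, Fintype.sum_prod_type,
    Matrix.kroneckerMap_apply, Matrix.one_apply, Matrix.submatrix_apply]
  rw [Finset.sum_comm]
  refine Finset.sum_congr rfl fun z _ => Finset.sum_congr rfl fun y _ => ?_
  rw [Finset.sum_eq_single z]
  · simp only [if_true, mul_one]; rfl
  · intro b _ hb; simp [hb.symm]
  · simp

/-! ### Expectation values -/

/-- The expectation value of `M` in the state `v`. -/
def expVal (v : (κ → Fin 2) → ℂ) (M : Op κ) : ℂ := star v ⬝ᵥ M *ᵥ v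

theorem trace_mul_density (v : (κ → Fin 2) → ℂ) (M : Op κ) :
    (M * density v).trace = expVal v M := by
  rw [density, Matrix.mul_vecMulVec, Matrix.trace_vecMulVec, dotProduct_comm, expVal]

theorem trace_pauliString_mul_reduced (S : Finset κ) (p : S → Fin 4) (v : (κ → Fin 2) → ℂ) :
    (pauliString p * reduced S (density v)).trace = expVal v (pauliString (extString S p)) := by
  rw [trace_mul_reduced, localOp_pauliString, trace_mul_density]

theorem expVal_add (v : (κ → Fin 2) → ℂ) (M N : Op κ) :
    expVal v (M + N) = expVal v M + expVal v N := by
  simp [expVal, Matrix.add_mulVec]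

theorem expVal_smul (v : (κ → Fin 2) → ℂ) (c : ℂ) (M : Op κ) :
    expVal v (c • M) = c * expVal v M := by
  simp [expVal, Matrix.smul_mulVec]

theorem expVal_neg (v : (κ → Fin 2) → ℂ) (M : Op κ) : expVal v (-M) = -expVal v M := by
  rw [← neg_one_smul ℂ, expVal_smul, neg_one_mul]

theorem expVal_one (v : (κ → Fin 2) → ℂ) : expVal v 1 = star v ⬝ᵥ v := by
  simp [expVal]

theorem expVal_conj_mulVec (v : (κ → Fin 2) → ℂ) (V M : Op κ) :
    expVal (V *ᵥ v) M = expVal v (Vᴴ * M * V) := by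
  simp only [expVal, Matrix.star_mulVec, ← Matrix.mulVec_mulVec, Matrix.dotProduct_mulVec,
    Matrix.vecMul_vecMul, Matrix.mul_assoc]

theorem expVal_mul_right_of_fixed {v : (κ → Fin 2) → ℂ} {N : Op κ} (h : N *ᵥ v = v)
    (M : Op κ) : expVal v (M * N) = expVal v M := by
  rw [expVal, ← Matrix.mulVec_mulVec, h, expVal]

theorem expVal_mul_left_of_fixed {v : (κ → Fin 2) → ℂ} {N : Op κ} (hN : Nᴴ = N)
    (h : N *ᵥ v = v) (M : Op κ) : expVal v (N * M) = expVal v M := by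
  rw [expVal, ← Matrix.mulVec_mulVec, Matrix.dotProduct_mulVec]
  nth_rewrite 1 [← hN]
  rw [← Matrix.star_mulVec, h, expVal]

theorem expVal_im_of_hermitian (v : (κ → Fin 2) → ℂ) {M : Op κ} (hM : Mᴴ = M) :
    (expVal v M).im = 0 := by
  rw [← Complex.conj_eq_iff_im]
  change star (star v ⬝ᵥ M *ᵥ v) = _
  rw [← Matrix.star_dotProduct, Matrix.star_mulVec, hM, ← Matrix.dotProduct_mulVec, expVal]

theorem expVal_pauliString_im (v : (κ → Fin 2) → ℂ) (p : κ → Fin 4) :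
    (expVal v (pauliString p)).im = 0 :=
  expVal_im_of_hermitian v (pauliString_conjTranspose p)

theorem normSq_I_pow (k : ℕ) : Complex.normSq (Complex.I ^ k) = 1 := by
  simp

theorem density_mulVec_self {v : (κ → Fin 2) → ℂ} (hv : star v ⬝ᵥ v = 1) :
    density v *ᵥ v = v := by
  rw [density, Matrix.vecMulVec_mulVec, hv]
  simp

theorem mulVec_eq_of_mul_density {v : (κ → Fin 2) → ℂ} (hv : star v ⬝ᵥ v = 1) {N : Op κ}
    (h : N * density v = density v) : N *ᵥ v = v := by
  have := congrArg (· *ᵥ v) h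
  simpa only [← Matrix.mulVec_mulVec, density_mulVec_self hv] using this

/-! ### Products of stabilizer factors -/

theorem mul_prod_one_add {R : Type*} [Ring R] {g : R} (hg : g * g = 1) :
    ∀ l : List R, (∀ h ∈ l, Commute g h) → g ∈ l →
      g * (l.map (1 + ·)).prod = (l.map (1 + ·)).prod
  | [], _, h => by simp at h
  | a :: l, hc, h => by
    rw [List.map_cons, List.prod_cons, ← mul_assoc]
    by_cases hag : g = a
    · subst hag
      rw [mul_add, mul_one, hg, add_comm]
    · have h1 : g * (1 + a) = (1 + a) * g :=
        (Commute.one_right g).add_right (hc a (by simp))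
      rw [h1, mul_assoc, mul_prod_one_add hg l (fun b hb => hc b (by simp [hb]))
        ((List.mem_cons.1 h).resolve_left hag)]

theorem stabProd_eq {m : ℕ} (g : Fin m → Op κ) :
    stabProd g = ((List.ofFn g).map (1 + ·)).prod := by
  rw [stabProd, List.map_ofFn]; rfl

theorem gen_mul_stabProd {m : ℕ} {g : Fin m → Op κ} (hg : ∀ j, IsHermitianPauli (g j))
    (hc : ∀ i j, Commute (g i) (g j)) (j : Fin m) : g j * stabProd g = stabProd g := by
  rw [stabProd_eq]
  refine mul_prod_one_add (hg j).mul_self _ ?_ ?_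
  · intro h hh
    obtain ⟨i, rfl⟩ := List.mem_ofFn.1 hh
    exact hc j i
  · exact List.mem_ofFn.2 ⟨j, rfl⟩

theorem commute_stabProd {m : ℕ} {g : Fin m → Op κ} {M : Op κ} (h : ∀ j, Commute M (g j)) :
    Commute M (stabProd g) := by
  rw [stabProd]
  refine Commute.list_prod_right _ _ fun x hx => ?_
  obtain ⟨i, rfl⟩ := List.mem_ofFn.1 hx
  exact (Commute.one_right M).add_right (h i)

/-- Expanding the product gives a sum of stabilizers. Membership in the span suffices for linear
arguments and avoids an explicit sum over subsets. -/
theorem stabProd_mem_span {m : ℕ} (g : Fin m → Op κ) :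
    stabProd g ∈ Submodule.span ℂ (Submonoid.closure (Set.range g) : Set (Op κ)) := by
  rw [← Algebra.adjoin_eq_span, Subalgebra.mem_toSubmodule, stabProd]
  refine Subalgebra.list_prod_mem _ fun x hx => ?_
  obtain ⟨i, rfl⟩ := List.mem_ofFn.1 hx
  exact add_mem (one_mem _) (Algebra.subset_adjoin ⟨i, rfl⟩)

theorem IsPauli.eq_of_trace_ne_zero {M : Op κ} (hM : IsPauli M) {p : κ → Fin 4}
    (h : (pauliString p * M).trace ≠ 0) : ∃ k : ℕ, M = Complex.I ^ k • pauliString p := by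
  obtain ⟨k, q, rfl⟩ := hM
  by_cases hpq : p = q
  · exact ⟨k, by rw [hpq]⟩
  · rw [mul_smul_comm, Matrix.trace_smul, trace_pauliString_mul_of_ne hpq, smul_zero] at h
    exact absurd rfl h

theorem extString_xorString (S : Finset κ) (p q : S → Fin 4) :
    extString S (xorString p q) = xorString (extString S p) (extString S q) := by
  funext i
  by_cases h : i ∈ S <;> simp [extString, xorString, h]

theorem xorString_right_injective (q : κ → Fin 4) :
    Function.Injective fun p : κ → Fin 4 => xorString p q :=
  fun _ _ h => funext fun i => fin4_xor_right_injective _ _ _ (congrFun h i)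

/-! ### Logical operators and Pauli expectation values of the encoded state -/

namespace Code

variable {L : ℕ} (K : Code L)

theorem commute_of_mem_stabGroup {M : Op (Fin L)} (hM : ∀ j, Commute M (K.gen j))
    {s : Op (Fin L)} (hs : s ∈ K.stabGroup) : Commute M s := by
  refine Submonoid.closure_induction (motive := fun s _ => Commute M s) ?_ ?_ ?_ hs
  · rintro _ ⟨j, rfl⟩; exact hM j
  · exact Commute.one_right M
  · intro x y _ _ hx hy; exact hx.mul_right hy

theorem mem_stabGroup_isPauli {s : Op (Fin L)} (hs : s ∈ K.stabGroup) : IsPauli s := by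
  refine Submonoid.closure_induction (motive := fun s _ => IsPauli s) ?_ ?_ ?_ hs
  · rintro _ ⟨j, rfl⟩; exact (K.gen_pauli j).isPauli
  · exact isPauli_one
  · intro x y _ _ hx hy; exact hx.mul hy

theorem mem_stabGroup_comm {s t : Op (Fin L)} (hs : s ∈ K.stabGroup) (ht : t ∈ K.stabGroup) :
    Commute s t :=
  K.commute_of_mem_stabGroup
    (fun j => (K.commute_of_mem_stabGroup (fun i => K.gen_commute j i) hs).symm) ht

theorem mem_stabGroup_conjTranspose {s : Op (Fin L)} (hs : s ∈ K.stabGroup) : sᴴ = s := by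
  refine Submonoid.closure_induction (motive := fun s _ => sᴴ = s) ?_ ?_ ?_ hs
  · rintro _ ⟨j, rfl⟩; exact (K.gen_pauli j).conjTranspose_eq
  · exact Matrix.conjTranspose_one
  · intro x y hx hy h1 h2
    rw [Matrix.conjTranspose_mul, h1, h2]
    exact K.mem_stabGroup_comm hy hx

theorem mem_stabGroup_mul_stabProd {s : Op (Fin L)} (hs : s ∈ K.stabGroup) :
    s * stabProd K.gen = stabProd K.gen := by
  refine Submonoid.closure_induction (motive := fun s _ => s * stabProd K.gen = stabProd K.gen)
    ?_ ?_ ?_ hs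
  · rintro _ ⟨j, rfl⟩; exact gen_mul_stabProd K.gen_pauli K.gen_commute j
  · exact one_mul _
  · intro x y _ _ hx hy; rw [mul_assoc, hy, hx]

theorem logY_commute (j) : Commute K.logY (K.gen j) :=
  ((K.logX_commute j).mul_left (K.logZ_commute j)).smul_left _

theorem logY_mul_logZ : K.logY * K.logZ = Complex.I • K.logX := by
  rw [logY, smul_mul_assoc, mul_assoc, K.logZ_pauli.mul_self, mul_one]

theorem logZ_mul_logY : K.logZ * K.logY = -(Complex.I • K.logX) := by
  rw [logY, mul_smul_comm, K.anticomm, mul_neg, ← mul_assoc, K.logZ_pauli.mul_self, one_mul,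
    smul_neg]

theorem logZ_logY_anticomm : K.logZ * K.logY = -(K.logY * K.logZ) := by
  rw [logZ_mul_logY, logY_mul_logZ]

theorem logY_conjTranspose : K.logYᴴ = K.logY := by
  rw [logY, Matrix.conjTranspose_smul, Matrix.conjTranspose_mul, K.logX_pauli.conjTranspose_eq,
    K.logZ_pauli.conjTranspose_eq, K.anticomm]
  simp

theorem logY_pauli : IsHermitianPauli K.logY := by
  refine IsPauli.isHermitianPauli ?_ K.logY_conjTranspose
  have := (K.logX_pauli.isPauli.mul K.logZ_pauli.isPauli).I_pow_smul 1
  rwa [pow_one] at this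

theorem invSqrtTwo_mul_self :
    ((Real.sqrt 2 : ℝ) : ℂ)⁻¹ * ((Real.sqrt 2 : ℝ) : ℂ)⁻¹ = 1 / 2 := by
  rw [← mul_inv, ← Complex.ofReal_mul, Real.mul_self_sqrt (by norm_num)]
  norm_num

/-- The logical observable `(Z̄ - Ȳ)/√2` that stabilizes the encoded magic state. -/
def logW : Op (Fin L) := ((Real.sqrt 2 : ℝ) : ℂ)⁻¹ • (K.logZ - K.logY)

theorem logW_mul_self : K.logW * K.logW = 1 := by
  rw [logW, smul_mul_smul_comm, invSqrtTwo_mul_self, sub_mul, mul_sub, mul_sub,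
    K.logZ_pauli.mul_self, K.logY_pauli.mul_self, K.logZ_logY_anticomm]
  rw [show (1 - -(K.logY * K.logZ) - (K.logY * K.logZ - 1) : Op (Fin L)) = (2 : ℂ) • 1 by
    rw [two_smul]; abel, smul_smul]
  norm_num

theorem logW_conjTranspose : K.logWᴴ = K.logW := by
  rw [logW, Matrix.conjTranspose_smul, Matrix.conjTranspose_sub, K.logY_conjTranspose,
    K.logZ_pauli.conjTranspose_eq]
  simp

theorem logW_commute (j) : Commute K.logW (K.gen j) :=
  ((K.logZ_commute j).sub_left (K.logY_commute j)).smul_left _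

variable {K} {ψ : (Fin L → Fin 2) → ℂ}

theorem IsOneUnitState.density_eq (hψ : K.IsOneUnitState ψ) :
    density ψ = ((2 : ℂ) ^ L)⁻¹ • ((1 + K.logW) * stabProd K.gen) := hψ.2

theorem IsOneUnitState.logW_mulVec (hψ : K.IsOneUnitState ψ) : K.logW *ᵥ ψ = ψ := by
  refine mulVec_eq_of_mul_density hψ.1 ?_
  rw [hψ.density_eq, mul_smul_comm, ← mul_assoc, mul_add, mul_one, K.logW_mul_self, add_comm]

theorem IsOneUnitState.stab_mulVec (hψ : K.IsOneUnitState ψ) {s : Op (Fin L)}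
    (hs : s ∈ K.stabGroup) : s *ᵥ ψ = ψ := by
  refine mulVec_eq_of_mul_density hψ.1 ?_
  have h : Commute (1 + K.logW) s :=
    K.commute_of_mem_stabGroup (fun j => (Commute.one_left _).add_left (K.logW_commute j)) hs
  rw [hψ.density_eq, mul_smul_comm, ← mul_assoc, ← h.eq, mul_assoc,
    K.mem_stabGroup_mul_stabProd hs]

/-- As `logW` fixes `ψ`, both orders of its product with `M` have the expectation of `M`. A scalar
anticommutator therefore determines that value; for Z̄ and Ȳ it gives 1/√2 and -1/√2. -/
theorem IsOneUnitState.two_mul_expVal (hψ : K.IsOneUnitState ψ) {M : Op (Fin L)} {c : ℂ}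
    (h : K.logW * M + M * K.logW = c • 1) : 2 * expVal ψ M = c := by
  have := congrArg (expVal ψ) h
  rw [expVal_add, expVal_smul, expVal_one, hψ.1,
    expVal_mul_left_of_fixed K.logW_conjTranspose hψ.logW_mulVec,
    expVal_mul_right_of_fixed hψ.logW_mulVec] at this
  rw [two_mul, this, mul_one]

theorem IsOneUnitState.normSq_expVal_logZ (hψ : K.IsOneUnitState ψ) :
    Complex.normSq (expVal ψ K.logZ) = 1 / 2 := by
  have h : 2 * expVal ψ K.logZ = ((Real.sqrt 2 : ℝ) : ℂ)⁻¹ * 2 := by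
    refine hψ.two_mul_expVal ?_
    rw [logW, smul_mul_assoc, mul_smul_comm, ← smul_add, sub_mul, mul_sub,
      K.logZ_pauli.mul_self, K.logZ_logY_anticomm, mul_smul]
    congr 1
    rw [two_smul]; abel
  have h' : expVal ψ K.logZ = ((Real.sqrt 2 : ℝ) : ℂ)⁻¹ := by
    linear_combination h / 2
  rw [h', ← Complex.ofReal_inv, Complex.normSq_ofReal, ← mul_inv,
    Real.mul_self_sqrt (by norm_num)]
  norm_num

theorem IsOneUnitState.normSq_expVal_logY (hψ : K.IsOneUnitState ψ) :
    Complex.normSq (expVal ψ K.logY) = 1 / 2 := by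
  have h : 2 * expVal ψ K.logY = ((Real.sqrt 2 : ℝ) : ℂ)⁻¹ * (-2) := by
    refine hψ.two_mul_expVal ?_
    rw [logW, smul_mul_assoc, mul_smul_comm, ← smul_add, sub_mul, mul_sub,
      K.logY_pauli.mul_self, K.logZ_logY_anticomm, mul_smul]
    congr 1
    rw [neg_smul, two_smul]; abel
  have h' : expVal ψ K.logY = -((Real.sqrt 2 : ℝ) : ℂ)⁻¹ := by
    linear_combination h / 2
  rw [h', Complex.normSq_neg, ← Complex.ofReal_inv, Complex.normSq_ofReal, ← mul_inv,
    Real.mul_self_sqrt (by norm_num)]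
  norm_num

variable (K)

/-- The Pauli string `p` on `A` belongs, up to a phase, to the coset `M 𝒢`. -/
def InCoset (A : Finset (Fin L)) (M : Op (Fin L)) (p : A → Fin 4) : Prop :=
  ∃ s ∈ K.stabGroup, ∃ k : ℕ, M * s = Complex.I ^ k • pauliString (extString A p)

theorem InCoset.reducible {K : Code L} {A : Finset (Fin L)} {M : Op (Fin L)} {p : A → Fin 4}
    (h : K.InCoset A M p) : K.Reducible A M := by
  obtain ⟨s, hs, k, hk⟩ := h
  exact ⟨s, hs, k, extString A p, fun i hi => by simp [extString, hi], hk⟩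

theorem InCoset.sq_expVal {K : Code L} (hψ : K.IsOneUnitState ψ) {A : Finset (Fin L)}
    {M : Op (Fin L)} {p : A → Fin 4} (h : K.InCoset A M p) :
    (expVal ψ (pauliString (extString A p))).re ^ 2 = Complex.normSq (expVal ψ M) := by
  obtain ⟨s, hs, k, hk⟩ := h
  rw [← expVal_mul_right_of_fixed (hψ.stab_mulVec hs) M, hk, expVal_smul, Complex.normSq_mul,
    normSq_I_pow, one_mul, Complex.normSq_apply, expVal_pauliString_im]
  ring

-- If q lies in the coset M𝒢, multiplication by q injects M𝒢 into 𝒢, because (Ms)(Mt) = st.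
open Classical in
theorem card_inCoset_le (A : Finset (Fin L)) {M : Op (Fin L)} (hM : M * M = 1)
    (hc : ∀ j, Commute M (K.gen j)) :
    (Finset.univ.filter (K.InCoset A M)).card ≤ (Finset.univ.filter (K.InCoset A 1)).card := by
  rcases (Finset.univ.filter (K.InCoset A M)).eq_empty_or_nonempty with h | ⟨q, hq⟩
  · simp [h]
  obtain ⟨t, ht, l, hl⟩ := (Finset.mem_filter.1 hq).2
  refine Finset.card_le_card_of_injOn (fun p => xorString p q) ?_
    (xorString_right_injective q).injOn
  intro p hp
  obtain ⟨s, hs, k, hk⟩ := (Finset.mem_filter.1 hp).2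
  refine Finset.mem_filter.2 ⟨Finset.mem_univ _, s * t, mul_mem hs ht, ?_⟩
  obtain ⟨m, hm⟩ := pauliString_mul (extString A p) (extString A q)
  refine ⟨k + l + m, ?_⟩
  have h1 : s * t = M * s * (M * t) := by
    rw [(K.commute_of_mem_stabGroup hc hs).eq, mul_assoc, ← mul_assoc M M t, hM, one_mul]
  rw [one_mul, h1, hk, hl, smul_mul_smul_comm, hm, smul_smul, extString_xorString, pow_add,
    pow_add]

variable {K}

/-- The density operator lies in the span of the three cosets, and a Pauli string outside them, up
to phase, is trace-orthogonal to each member. -/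
theorem IsOneUnitState.inCoset_of_expVal_ne_zero (hψ : K.IsOneUnitState ψ)
    {A : Finset (Fin L)} {p : A → Fin 4}
    (h : expVal ψ (pauliString (extString A p)) ≠ 0) :
    K.InCoset A 1 p ∨ K.InCoset A K.logZ p ∨ K.InCoset A K.logY p := by
  set P := pauliString (extString A p) with hP
  by_contra hcon
  simp only [InCoset, not_or, not_exists, not_and] at hcon
  obtain ⟨h1, hZ, hY⟩ := hcon
  have key : ∀ M : Op (Fin L), IsPauli M →
      (∀ s ∈ K.stabGroup, ∀ k : ℕ, ¬ M * s = Complex.I ^ k • P) →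
      ∀ s ∈ K.stabGroup, (P * (M * s)).trace = 0 := by
    intro M hM hno s hs
    by_contra hne
    obtain ⟨k, hk⟩ := (hM.mul (K.mem_stabGroup_isPauli hs)).eq_of_trace_ne_zero hne
    exact hno s hs k hk
  have k1 := key 1 isPauli_one h1
  have kZ := key _ K.logZ_pauli.isPauli hZ
  have kY := key _ K.logY_pauli.isPauli hY
  have hz : ∀ T ∈ Submodule.span ℂ (K.stabGroup : Set (Op (Fin L))),
      (P * ((1 + K.logW) * T)).trace = 0 := by
    intro T hT
    induction hT using Submodule.span_induction with
    | mem s hs =>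
      have e : P * ((1 + K.logW) * s) = P * (1 * s) + ((Real.sqrt 2 : ℝ) : ℂ)⁻¹ •
          (P * (K.logZ * s) - P * (K.logY * s)) := by
        rw [logW, add_mul, mul_add, smul_mul_assoc, mul_smul_comm, sub_mul, mul_sub]
      rw [e, Matrix.trace_add, Matrix.trace_smul, Matrix.trace_sub, k1 s hs, kZ s hs, kY s hs]
      simp
    | zero => simp
    | add x y _ _ hx hy => rw [mul_add, mul_add, Matrix.trace_add, hx, hy, add_zero]
    | smul c x _ hx => rw [mul_smul_comm, mul_smul_comm, Matrix.trace_smul, hx, smul_zero]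
  apply h
  rw [← trace_mul_density, hψ.density_eq, mul_smul_comm, Matrix.trace_smul,
    hz _ (stabProd_mem_span K.gen), smul_zero]

/-- If only 𝒢 and N𝒢 contribute, the moment identity forces n₁ ≤ n_N/2, against n_N ≤ n₁ and n₁ > 0.
-/
theorem IsOneUnitState.false_of_two_cosets (hψ : K.IsOneUnitState ψ) {A : Finset (Fin L)}
    {N : Op (Fin L)} (hN : N * N = 1) (hc : ∀ j, Commute N (K.gen j))
    (hv : Complex.normSq (expVal ψ N) = 1 / 2)
    (hcov : ∀ p : A → Fin 4, expVal ψ (pauliString (extString A p)) ≠ 0 →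
      K.InCoset A 1 p ∨ K.InCoset A N p)
    (hsum : 4 * ∑ p : A → Fin 4, (expVal ψ (pauliString (extString A p))).re ^ 4 =
      3 * ∑ p : A → Fin 4, (expVal ψ (pauliString (extString A p))).re ^ 2) : False := by
  classical
  -- With t the squared expectation value, 4t² - 3t is 1 at t = 1, -1/2 at t = 1/2 and 0 at t = 0.
  -- An inequality suffices, so disjointness of the cosets need not be proved.
  have hpt : ∀ p : A → Fin 4,
      (if K.InCoset A 1 p then (1 : ℝ) else 0) - 1 / 2 * (if K.InCoset A N p then 1 else 0) ≤
      4 * (expVal ψ (pauliString (extString A p))).re ^ 4 -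
        3 * (expVal ψ (pauliString (extString A p))).re ^ 2 := by
    intro p
    have e4 : ∀ t : ℝ, t ^ 4 = (t ^ 2) ^ 2 := fun t => by ring
    rw [e4]
    by_cases h1 : K.InCoset A 1 p
    · rw [h1.sq_expVal hψ, expVal_one, hψ.1]
      simp only [h1, if_true, map_one]
      split_ifs <;> norm_num
    · by_cases h2 : K.InCoset A N p
      · rw [h2.sq_expVal hψ, hv]
        simp only [h1, h2, if_true, if_false]
        norm_num
      · have : expVal ψ (pauliString (extString A p)) = 0 := by
          by_contra hne
          rcases hcov p hne with h | h
          · exact h1 h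
          · exact h2 h
        simp [this, h1, h2]
  have hs := Finset.sum_le_sum fun p (_ : p ∈ Finset.univ) => hpt p
  rw [Finset.sum_sub_distrib, Finset.sum_sub_distrib, ← Finset.mul_sum, ← Finset.mul_sum,
    ← Finset.mul_sum, hsum, sub_self, Finset.sum_boole, Finset.sum_boole] at hs
  have hle : ((Finset.univ.filter (K.InCoset A N)).card : ℝ) ≤
      (Finset.univ.filter (K.InCoset A 1)).card := by
    exact_mod_cast K.card_inCoset_le A hN hc
  have hpos : (0 : ℝ) < (Finset.univ.filter (K.InCoset A 1)).card := by
    refine Nat.cast_pos.2 (Finset.card_pos.2 ⟨0, Finset.mem_filter.2 ⟨Finset.mem_univ _, ?_⟩⟩)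
    refine ⟨1, one_mem _, 0, ?_⟩
    have : extString A (0 : A → Fin 4) = 0 := by funext i; simp [extString]
    rw [this, pauliString_zero]
    simp
  linarith

end Code

/-! ### From entropy to reducibility -/

theorem expVal_ext_zero {v : (κ → Fin 2) → ℂ} (hv : star v ⬝ᵥ v = 1) (A : Finset κ) :
    expVal v (pauliString (extString A 0)) = 1 := by
  have : extString A (0 : A → Fin 4) = 0 := by funext i; simp [extString]
  rw [this, pauliString_zero, expVal_one, hv]

/-- The identity string contributes 1, so both sums are positive and the logarithm can be cancelled.
-/
theorem stabilizerEntropy_reduced_eq_iff {v : (κ → Fin 2) → ℂ} (hv : star v ⬝ᵥ v = 1)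
    (A : Finset κ) :
    stabilizerEntropy (reduced A (density v)) = Real.logb 2 (4 / 3) ↔
      4 * ∑ p : A → Fin 4, (expVal v (pauliString (extString A p))).re ^ 4 =
        3 * ∑ p : A → Fin 4, (expVal v (pauliString (extString A p))).re ^ 2 := by
  simp only [stabilizerEntropy, trace_pauliString_mul_reduced]
  have hpos : ∀ k : ℕ, Even k →
      0 < ∑ p : A → Fin 4, (expVal v (pauliString (extString A p))).re ^ k := by
    intro k hk
    refine Finset.sum_pos' (fun p _ => hk.pow_nonneg _) ⟨0, Finset.mem_univ _, ?_⟩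
    rw [expVal_ext_zero hv]
    simp
  have h4 := hpos 4 (by decide)
  have h2 := hpos 2 (by decide)
  rw [← Real.logb_inv, inv_div]
  set s4 := ∑ p : A → Fin 4, (expVal v (pauliString (extString A p))).re ^ 4
  set s2 := ∑ p : A → Fin 4, (expVal v (pauliString (extString A p))).re ^ 2
  constructor
  · intro h
    have := Real.logb_injOn_pos (b := 2) (by norm_num) (Set.mem_Ioi.2 (div_pos h2 h4))
      (Set.mem_Ioi.2 (by norm_num)) h
    rw [div_eq_div_iff h4.ne' (by norm_num)] at this
    linarith
  · intro h
    congr 1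
    rw [div_eq_div_iff h4.ne' (by norm_num)]
    linarith

theorem Code.reducible_of_stabilizerEntropy {L : ℕ} {K : Code L} {ψ : (Fin L → Fin 2) → ℂ}
    (hψ : K.IsOneUnitState ψ) {A : Finset (Fin L)}
    (h : stabilizerEntropy (reduced A (density ψ)) = Real.logb 2 (4 / 3)) :
    K.Reducible A K.logX ∧ K.Reducible A K.logY ∧ K.Reducible A K.logZ := by
  rw [stabilizerEntropy_reduced_eq_iff hψ.1] at h
  have hZ : K.Reducible A K.logZ := by
    by_contra hno
    refine hψ.false_of_two_cosets K.logY_pauli.mul_self K.logY_commute hψ.normSq_expVal_logY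
      (fun p hp => ?_) h
    rcases hψ.inCoset_of_expVal_ne_zero hp with h1 | h1 | h1
    · exact Or.inl h1
    · exact absurd h1.reducible hno
    · exact Or.inr h1
  have hY : K.Reducible A K.logY := by
    by_contra hno
    refine hψ.false_of_two_cosets K.logZ_pauli.mul_self K.logZ_commute hψ.normSq_expVal_logZ
      (fun p hp => ?_) h
    rcases hψ.inCoset_of_expVal_ne_zero hp with h1 | h1 | h1
    · exact Or.inl h1
    · exact Or.inr h1
    · exact absurd h1.reducible hno
  refine ⟨?_, hY, hZ⟩
  obtain ⟨s, hs, k, p, hp, hk⟩ := hY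
  obtain ⟨t, ht, l, q, hq, hl⟩ := hZ
  obtain ⟨m, hm⟩ := pauliString_mul p q
  -- The summand 3 undoes the factor i in ȲZ̄ = iX̄.
  refine ⟨s * t, mul_mem hs ht, 3 + (k + l + m), xorString p q, fun i hi => ?_, ?_⟩
  · rw [xorString, hp i hi, hq i hi]; rfl
  · have h1 : K.logY * s * (K.logZ * t) = Complex.I • (K.logX * (s * t)) := by
      rw [mul_assoc, ← mul_assoc s, ← (K.commute_of_mem_stabGroup K.logZ_commute hs).eq,
        mul_assoc, ← mul_assoc, K.logY_mul_logZ, smul_mul_assoc]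
    have h2 : K.logX * (s * t) = Complex.I ^ 3 • (K.logY * s * (K.logZ * t)) := by
      rw [h1, smul_smul, ← pow_succ, Complex.I_pow_four, one_smul]
    rw [h2, hk, hl, smul_mul_smul_comm, hm, smul_smul, smul_smul]
    congr 1
    ring

/-! ### Adjoining the ancilla -/

/-- The product operator `M ⊗ N` on a register and an ancilla qubit. -/
def kron (M : Op κ) (N : Matrix (Fin 2) (Fin 2) ℂ) : Op (Option κ) :=
  Matrix.of fun x y => M (fun i => x (some i)) (fun i => y (some i)) * N (x none) (y none)

theorem sum_option_fun {β : Type*} [AddCommMonoid β] (f : (Option κ → Fin 2) → β) :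
    ∑ x, f x = ∑ a : Fin 2, ∑ y : κ → Fin 2, f ((Equiv.piOptionEquivProd).symm (a, y)) := by
  rw [← Equiv.sum_comp (Equiv.piOptionEquivProd (β := fun _ : Option κ => Fin 2)).symm f,
    Fintype.sum_prod_type]

theorem kron_mul (M M' : Op κ) (N N' : Matrix (Fin 2) (Fin 2) ℂ) :
    kron M N * kron M' N' = kron (M * M') (N * N') := by
  ext x y
  simp only [kron, Matrix.mul_apply, Matrix.of_apply, sum_option_fun, Equiv.piOptionEquivProd,
    Equiv.coe_fn_symm_mk, Finset.sum_mul_sum]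
  rw [Finset.sum_comm]
  exact Finset.sum_congr rfl fun _ _ => Finset.sum_congr rfl fun _ _ => by ring

theorem kron_one_one : kron (1 : Op κ) 1 = 1 := by
  ext x y
  by_cases h : x = y
  · subst h; simp [kron]
  · rw [Matrix.one_apply_ne h]
    by_cases h0 : x none = y none
    · have : (fun i => x (some i)) ≠ fun i => y (some i) := fun h1 => h <| by
        funext i
        cases i with
        | none => exact h0
        | some i => exact congrFun h1 i
      simp [kron, Matrix.one_apply_ne this]
    · simp [kron, Matrix.one_apply_ne h0]

theorem pauliString_option (q : Option κ → Fin 4) :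
    pauliString q = kron (pauliString fun i => q (some i)) (pauliMat (q none)) := by
  ext x y
  simp only [kron, pauliString, Matrix.of_apply, Fintype.prod_option]
  ring

section Ancilla

variable {L : ℕ}

theorem kron_mulVec_withAncilla (M : Op (Fin L)) (N : Matrix (Fin 2) (Fin 2) ℂ)
    (φ : (Fin L → Fin 2) → ℂ) (χ : Fin 2 → ℂ) :
    kron M N *ᵥ withAncilla φ χ = withAncilla (M *ᵥ φ) (N *ᵥ χ) := by
  funext x
  simp only [kron, withAncilla, Matrix.mulVec, dotProduct, Matrix.of_apply, sum_option_fun,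
    Equiv.piOptionEquivProd, Equiv.coe_fn_symm_mk, Finset.sum_mul_sum]
  rw [Finset.sum_comm]
  exact Finset.sum_congr rfl fun _ _ => Finset.sum_congr rfl fun _ _ => by ring

theorem star_withAncilla_dotProduct (φ φ' : (Fin L → Fin 2) → ℂ) (χ χ' : Fin 2 → ℂ) :
    star (withAncilla φ χ) ⬝ᵥ withAncilla φ' χ' = (star φ ⬝ᵥ φ') * (star χ ⬝ᵥ χ') := by
  simp only [withAncilla, dotProduct, sum_option_fun, Pi.star_apply, star_mul',
    Equiv.piOptionEquivProd, Equiv.coe_fn_symm_mk, Finset.sum_mul_sum]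
  rw [Finset.sum_comm]
  exact Finset.sum_congr rfl fun _ _ => Finset.sum_congr rfl fun _ _ => by ring

theorem expVal_withAncilla_kron (φ : (Fin L → Fin 2) → ℂ) (χ : Fin 2 → ℂ) (M : Op (Fin L))
    (N : Matrix (Fin 2) (Fin 2) ℂ) :
    expVal (withAncilla φ χ) (kron M N) = expVal φ M * (star χ ⬝ᵥ N *ᵥ χ) := by
  rw [expVal, kron_mulVec_withAncilla, star_withAncilla_dotProduct, expVal]

theorem density_withAncilla (φ : (Fin L → Fin 2) → ℂ) (χ : Fin 2 → ℂ) :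
    density (withAncilla φ χ) = kron (density φ) (Matrix.vecMulVec χ (star χ)) := by
  ext x y
  simp only [density, withAncilla, kron, Matrix.vecMulVec_apply, Matrix.of_apply, Pi.star_apply,
    star_mul']
  ring

/-- Functions on the qubits of `A` and an ancilla. -/
def insertNoneFunEquiv (A : Finset κ) :
    (Finset.insertNone A → Fin 4) ≃ (A → Fin 4) × Fin 4 where
  toFun p := (fun i => p ⟨some i, Finset.some_mem_insertNone.2 i.2⟩,
    p ⟨none, Finset.none_mem_insertNone⟩)
  invFun q := fun i => match i with
    | ⟨none, _⟩ => q.2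
    | ⟨some i, h⟩ => q.1 ⟨i, Finset.some_mem_insertNone.1 h⟩
  left_inv p := by
    funext i
    rcases i with ⟨_ | i, h⟩ <;> rfl
  right_inv q := rfl

theorem pauliString_extString_insertNone (A : Finset κ) (q : A → Fin 4) (a : Fin 4) :
    pauliString (extString (Finset.insertNone A) ((insertNoneFunEquiv A).symm (q, a))) =
      kron (pauliString (extString A q)) (pauliMat a) := by
  rw [pauliString_option]
  congr 2
  · funext i
    simp only [extString, Finset.some_mem_insertNone]
    rfl
  · simp only [extString, Finset.none_mem_insertNone, dif_pos]
    rfl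

theorem sum_expVal_withAncilla (A : Finset (Fin L)) (φ : (Fin L → Fin 2) → ℂ) (χ : Fin 2 → ℂ)
    (k : ℕ) :
    ∑ p : Finset.insertNone A → Fin 4,
        (expVal (withAncilla φ χ) (pauliString (extString (Finset.insertNone A) p))).re ^ k =
      (∑ p : A → Fin 4, (expVal φ (pauliString (extString A p))).re ^ k) *
        ∑ a : Fin 4, (star χ ⬝ᵥ pauliMat a *ᵥ χ).re ^ k := by
  rw [← Equiv.sum_comp (insertNoneFunEquiv A).symm, Fintype.sum_prod_type, Finset.sum_mul_sum]
  refine Finset.sum_congr rfl fun q _ => Finset.sum_congr rfl fun a _ => ?_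
  rw [pauliString_extString_insertNone, expVal_withAncilla_kron, Complex.mul_re,
    expVal_pauliString_im, zero_mul, sub_zero, mul_pow]

end Ancilla

/-! ### Pauli moments of |0⟩, |T⟩ and stabilizer states -/

theorem sum_pauliMat_ketZero (k : ℕ) (hk : k ≠ 0) :
    ∑ a : Fin 4, (star ketZero ⬝ᵥ pauliMat a *ᵥ ketZero).re ^ k = 2 := by
  simp [Fin.sum_univ_four, pauliMat, ketZero, dotProduct, Matrix.mulVec, Fin.sum_univ_two, hk]
  norm_num

theorem ketT_eq : ketT = ![((Real.sqrt 2 : ℝ) : ℂ)⁻¹, (1 + Complex.I) / 2] := by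
  have h : Complex.exp (Complex.I * Real.pi / 4) =
      ((Real.sqrt 2 : ℝ) : ℂ) / 2 * (1 + Complex.I) := by
    rw [show Complex.I * Real.pi / 4 = ((Real.pi / 4 : ℝ) : ℂ) * Complex.I by push_cast; ring,
      Complex.exp_mul_I, ← Complex.ofReal_cos, ← Complex.ofReal_sin, Real.cos_pi_div_four,
      Real.sin_pi_div_four]
    push_cast
    ring
  have h0 : ((Real.sqrt 2 : ℝ) : ℂ) ≠ 0 := by simp
  rw [ketT, h]
  funext i
  fin_cases i
  · simp
  · simp
    field_simp

theorem vecMulVec_ketT : Matrix.vecMulVec ketT (star ketT) =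
    (1 / 2 : ℂ) • (1 + ((Real.sqrt 2 : ℝ) : ℂ)⁻¹ • (pauliMat 1 + pauliMat 2)) := by
  have h := Code.invSqrtTwo_mul_self
  rw [ketT_eq]
  set r : ℂ := ((Real.sqrt 2 : ℝ) : ℂ)⁻¹ with hr
  have hs : (starRingEnd ℂ) r = r := by rw [hr, map_inv₀, Complex.conj_ofReal]
  ext i j
  fin_cases i <;> fin_cases j <;> simp [Matrix.vecMulVec_apply, pauliMat, hs]
  · rw [h]; norm_num
  · ring
  · ring
  · linear_combination -(1 / 4 : ℂ) * Complex.I_sq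

theorem expVal_ketT : (fun a => (star ketT ⬝ᵥ pauliMat a *ᵥ ketT).re) =
    ![1, (Real.sqrt 2)⁻¹, (Real.sqrt 2)⁻¹, 0] := by
  have h : (Real.sqrt 2)⁻¹ * (Real.sqrt 2)⁻¹ = 1 / 2 := by
    rw [← mul_inv, Real.mul_self_sqrt (by norm_num)]; norm_num
  have hc : ((Real.sqrt 2 : ℝ) : ℂ)⁻¹ = (((Real.sqrt 2)⁻¹ : ℝ) : ℂ) := by simp
  rw [ketT_eq, hc]
  set r : ℝ := (Real.sqrt 2)⁻¹
  have e : (1 + Complex.I) / 2 = ⟨1 / 2, 1 / 2⟩ := by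
    apply Complex.ext <;> simp
  rw [e]
  funext a
  fin_cases a <;> simp [pauliMat, dotProduct, Matrix.mulVec, Fin.sum_univ_two] <;>
    nlinarith [h]

theorem sum_sq_ketT : ∑ a : Fin 4, (star ketT ⬝ᵥ pauliMat a *ᵥ ketT).re ^ 2 = 2 := by
  have h : (Real.sqrt 2)⁻¹ ^ 2 = 1 / 2 := by
    rw [inv_pow, Real.sq_sqrt (by norm_num)]; norm_num
  simp only [congrFun expVal_ketT]
  simp only [Fin.sum_univ_four, Matrix.cons_val]
  rw [h]; norm_num

theorem sum_fourth_ketT : ∑ a : Fin 4, (star ketT ⬝ᵥ pauliMat a *ᵥ ketT).re ^ 4 = 3 / 2 := by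
  have h : (Real.sqrt 2)⁻¹ ^ 2 = 1 / 2 := by
    rw [inv_pow, Real.sq_sqrt (by norm_num)]; norm_num
  have h4 : (Real.sqrt 2)⁻¹ ^ 4 = 1 / 4 := by
    rw [show (4 : ℕ) = 2 * 2 from rfl, pow_mul, h]; norm_num
  simp only [congrFun expVal_ketT]
  simp only [Fin.sum_univ_four, Matrix.cons_val]
  rw [h4]; norm_num

/-- A string commuting with all generators commutes with the projector, so `φ` is an eigenvector
with eigenvalue ±1. A string anticommuting with some generator has an expectation equal to its own
negative. -/
theorem IsStabilizerState.expVal_pauliString_sq {φ : (κ → Fin 2) → ℂ} (hφ : IsStabilizerState φ)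
    (p : κ → Fin 4) :
    (expVal φ (pauliString p)).re ^ 2 = 0 ∨ (expVal φ (pauliString p)).re ^ 2 = 1 := by
  obtain ⟨h1, s, hs, hc, hd⟩ := hφ
  have hfix : ∀ j, s j *ᵥ φ = φ := fun j => by
    refine mulVec_eq_of_mul_density h1 ?_
    rw [hd, mul_smul_comm, gen_mul_stabProd hs hc]
  by_cases hcomm : ∀ j, Commute (pauliString p) (s j)
  · right
    have h2 : pauliString p * density φ = density φ * pauliString p := by
      rw [hd, mul_smul_comm, smul_mul_assoc, (commute_stabProd hcomm).eq]
    have h3 : pauliString p *ᵥ φ = expVal φ (pauliString p) • φ := by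
      have := congrArg (· *ᵥ φ) h2
      simp only [← Matrix.mulVec_mulVec, density_mulVec_self h1] at this
      rw [this, density, Matrix.vecMulVec_mulVec]
      simp [expVal]
    have h4 : expVal φ (pauliString p) * expVal φ (pauliString p) = 1 := by
      have : expVal φ (pauliString p * pauliString p) = 1 := by
        rw [pauliString_mul_self, expVal_one, h1]
      rw [← this, expVal, expVal, ← Matrix.mulVec_mulVec, h3, Matrix.mulVec_smul, h3]
      simp [h1]
    have h5 := congrArg Complex.re h4
    rw [Complex.mul_re, expVal_pauliString_im] at h5
    simp only [mul_zero, sub_zero, Complex.one_re] at h5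
    rw [sq, h5]
  · left
    obtain ⟨j, hj⟩ := not_forall.1 hcomm
    have h2 := ((isPauli_pauliString p).commute_or_anticommute (hs j).isPauli).resolve_left hj
    have h3 := congrArg (expVal φ) h2
    rw [expVal_neg, expVal_mul_right_of_fixed (hfix j),
      expVal_mul_left_of_fixed (hs j).conjTranspose_eq (hfix j)] at h3
    have h4 : expVal φ (pauliString p) = 0 := self_eq_neg.1 h3
    rw [h4]; simp

/-! ### Clifford invariance and the entropy of extractable magic -/

/-- Conjugation preserves Hermiticity, leaving only signs as phases. It is invertible, hence
injective on labels, and the set of labels is finite. -/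
theorem IsClifford.exists_perm {U : Op κ} (hU : IsClifford U) :
    ∃ π : Equiv.Perm (κ → Fin 4), ∀ p, U * pauliString p * Uᴴ = pauliString (π p) ∨
      U * pauliString p * Uᴴ = -pauliString (π p) := by
  have hUU : Uᴴ * U = 1 := hU.1.1
  have h : ∀ p, IsHermitianPauli (U * pauliString p * Uᴴ) := fun p => by
    refine (hU.2 _ (isPauli_pauliString p)).isHermitianPauli ?_
    rw [Matrix.conjTranspose_mul, Matrix.conjTranspose_mul, Matrix.conjTranspose_conjTranspose,
      pauliString_conjTranspose, mul_assoc]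
  choose f hf using h
  have hcancel : ∀ p, Uᴴ * (U * pauliString p * Uᴴ) * U = pauliString p := fun p => by
    rw [← mul_assoc, ← mul_assoc, hUU, one_mul, mul_assoc, hUU, mul_one]
  have hinj : Function.Injective f := by
    intro p q hpq
    have hp := hf p
    have hq := hf q
    rw [hpq] at hp
    have : U * pauliString p * Uᴴ = (1 : ℂ) • (U * pauliString q * Uᴴ) ∨
        U * pauliString p * Uᴴ = (-1 : ℂ) • (U * pauliString q * Uᴴ) := by
      rcases hp with hp | hp <;> rcases hq with hq | hq <;> simp [hp, hq]
    rcases this with h | h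
    all_goals
      apply eq_of_pauliString_eq_smul (c := _)
      rw [← hcancel p, h, mul_smul_comm, smul_mul_assoc, hcancel q]
  exact ⟨Equiv.ofBijective f (Finite.injective_iff_bijective.1 hinj), hf⟩

theorem sum_expVal_clifford {S : Finset κ} {U : Op S} (hU : IsClifford U)
    (v : (κ → Fin 2) → ℂ) {k : ℕ} (hk : Even k) :
    ∑ p : S → Fin 4, (expVal (localOp S U *ᵥ v) (pauliString (extString S p))).re ^ k =
      ∑ p : S → Fin 4, (expVal v (pauliString (extString S p))).re ^ k := by
  obtain ⟨π, hπ⟩ := hU.exists_perm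
  have hUU : Uᴴ * U = 1 := hU.1.1
  rw [← Equiv.sum_comp π]
  refine Finset.sum_congr rfl fun p _ => ?_
  have h1 : expVal (localOp S U *ᵥ v) (localOp S (U * pauliString p * Uᴴ)) =
      expVal v (pauliString (extString S p)) := by
    rw [expVal_conj_mulVec, ← localOp_conjTranspose, ← localOp_pauliString]
    simp only [← localHom_apply, ← map_mul]
    rw [← mul_assoc, ← mul_assoc, hUU, one_mul, mul_assoc, hUU, mul_one]
  rw [← h1, ← localOp_pauliString]
  rcases hπ p with h | h
  · rw [h]
  · rw [h, ← localHom_apply S (pauliString _), ← localHom_apply S (-pauliString _), map_neg, expVal_neg, Complex.neg_re, hk.neg_pow]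

theorem UnitarilyExtractable.stabilizerEntropy_eq {L : ℕ} {A : Finset (Fin L)}
    {ψ : (Fin L → Fin 2) → ℂ} (hψ : star ψ ⬝ᵥ ψ = 1) (h : UnitarilyExtractable A ψ) :
    stabilizerEntropy (reduced A (density ψ)) = Real.logb 2 (4 / 3) := by
  obtain ⟨U, hU, φ, hφ, hw⟩ := h
  have key : ∀ k, Even k → k ≠ 0 →
      (∑ p : A → Fin 4, (expVal ψ (pauliString (extString A p))).re ^ k) * 2 =
      (∑ p : A → Fin 4, (expVal φ (pauliString (extString A p))).re ^ k) *
        ∑ a : Fin 4, (star ketT ⬝ᵥ pauliMat a *ᵥ ketT).re ^ k := by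
    intro k hk hk0
    rw [← sum_expVal_withAncilla, ← hw, sum_expVal_clifford hU _ hk, sum_expVal_withAncilla,
      sum_pauliMat_ketZero k hk0]
  have h2 := key 2 (by decide) (by decide)
  have h4 := key 4 (by decide) (by decide)
  rw [sum_sq_ketT] at h2
  -- Squares in {0, 1} equalize the two moments of `φ`, so the ratio for `ψ` is that of |T⟩, (3/2)/2
  -- = 3/4.
  have hφ4 : ∑ p : A → Fin 4, (expVal φ (pauliString (extString A p))).re ^ 4 =
      ∑ p : A → Fin 4, (expVal φ (pauliString (extString A p))).re ^ 2 := by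
    refine Finset.sum_congr rfl fun p _ => ?_
    rw [show (4 : ℕ) = 2 * 2 from rfl, pow_mul]
    rcases hφ.expVal_pauliString_sq (extString A p) with h | h <;> rw [h] <;> norm_num
  rw [sum_fourth_ketT, hφ4] at h4
  rw [stabilizerEntropy_reduced_eq_iff hψ]
  linarith

/-! ### Controlled-sign gates of commuting involutions -/

section CZ

variable {R : Type*} [Ring R] [Algebra ℂ R]

/-- The controlled-sign gate of two commuting involutions: it acts as `-1` where both are `-1`. -/
def czGate (u v : R) : R := (1 / 2 : ℂ) • (1 + u + v - u * v)

variable {u v Q : R}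

theorem czGate_mul_self (hu : u * u = 1) (hv : v * v = 1) (huv : u * v = v * u) :
    czGate u v * czGate u v = 1 := by
  have hu' : ∀ x, u * (u * x) = x := fun x => by rw [← mul_assoc, hu, one_mul]
  have hvu' : ∀ x, v * (u * x) = u * (v * x) := fun x => by rw [← mul_assoc, ← huv, mul_assoc]
  simp only [czGate, smul_mul_smul_comm, mul_add, add_mul, mul_sub, sub_mul, one_mul, mul_one,
    mul_assoc, hu, hv, ← huv, hu', hvu']
  module

theorem czGate_conj_of_commute (hu : u * u = 1) (hv : v * v = 1) (huv : u * v = v * u)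
    (h1 : Q * u = u * Q) (h2 : Q * v = v * Q) : czGate u v * Q * czGate u v = Q := by
  have : czGate u v * Q = Q * czGate u v := by
    simp only [czGate, smul_mul_assoc, mul_smul_comm, mul_add, add_mul, mul_sub, sub_mul, one_mul,
      mul_one, h1, h2, mul_assoc]
    rw [← h2, ← mul_assoc Q, h1, mul_assoc]
  rw [this, mul_assoc, czGate_mul_self hu hv huv, mul_one]

/-- Moving Q through the gate replaces u by -u. The two gates together have sign -1 exactly where v
= -1, so their product is v. The other anticommuting cases follow the same pattern. -/
theorem czGate_conj_of_anticommute_left (hu : u * u = 1) (hv : v * v = 1) (huv : u * v = v * u)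
    (h1 : Q * u = -(u * Q)) (h2 : Q * v = v * Q) :
    czGate u v * Q * czGate u v = v * Q := by
  have hu' : ∀ x, u * (u * x) = x := fun x => by rw [← mul_assoc, hu, one_mul]
  have hv' : ∀ x, v * (v * x) = x := fun x => by rw [← mul_assoc, hv, one_mul]
  have hvu' : ∀ x, v * (u * x) = u * (v * x) := fun x => by rw [← mul_assoc, ← huv, mul_assoc]
  have h1' : ∀ x, Q * (u * x) = -(u * (Q * x)) := fun x => by
    rw [← mul_assoc, h1, neg_mul, mul_assoc]
  simp only [czGate, smul_mul_assoc, mul_smul_comm, mul_add, add_mul, mul_sub, sub_mul,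
    one_mul, mul_one, mul_assoc, h1, h2, h1', hu', hv', hvu', mul_neg]
  module

theorem czGate_conj_of_anticommute_right (hu : u * u = 1) (hv : v * v = 1) (huv : u * v = v * u)
    (h1 : Q * u = u * Q) (h2 : Q * v = -(v * Q)) :
    czGate u v * Q * czGate u v = u * Q := by
  have hu' : ∀ x, u * (u * x) = x := fun x => by rw [← mul_assoc, hu, one_mul]
  have hv' : ∀ x, v * (v * x) = x := fun x => by rw [← mul_assoc, hv, one_mul]
  have hvu' : ∀ x, v * (u * x) = u * (v * x) := fun x => by rw [← mul_assoc, ← huv, mul_assoc]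
  have h1' : ∀ x, Q * (u * x) = u * (Q * x) := fun x => by
    rw [← mul_assoc, h1, mul_assoc]
  simp only [czGate, smul_mul_assoc, mul_smul_comm, mul_add, add_mul, mul_sub, sub_mul,
    one_mul, mul_one, mul_assoc, h1, h2, h1', hu', hv', hvu', mul_neg]
  module

theorem czGate_conj_of_anticommute_both (hu : u * u = 1) (hv : v * v = 1) (huv : u * v = v * u)
    (h1 : Q * u = -(u * Q)) (h2 : Q * v = -(v * Q)) :
    czGate u v * Q * czGate u v = -(u * v * Q) := by
  have hu' : ∀ x, u * (u * x) = x := fun x => by rw [← mul_assoc, hu, one_mul]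
  have hv' : ∀ x, v * (v * x) = x := fun x => by rw [← mul_assoc, hv, one_mul]
  have hvu' : ∀ x, v * (u * x) = u * (v * x) := fun x => by rw [← mul_assoc, ← huv, mul_assoc]
  have h1' : ∀ x, Q * (u * x) = -(u * (Q * x)) := fun x => by
    rw [← mul_assoc, h1, neg_mul, mul_assoc]
  simp only [czGate, smul_mul_assoc, mul_smul_comm, mul_add, add_mul, mul_sub, sub_mul,
    one_mul, mul_one, mul_assoc, h1, h2, h1', hu', hv', hvu', mul_neg]
  module

theorem map_czGate {R' : Type*} [Ring R'] [Algebra ℂ R'] (f : R →ₐ[ℂ] R') (u v : R) :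
    f (czGate u v) = czGate (f u) (f v) := by
  simp only [czGate, map_smul, map_sub, map_add, map_one, map_mul]

end CZ

theorem czGate_conjTranspose {u v : Op κ} (hu : uᴴ = u) (hv : vᴴ = v) (huv : u * v = v * u) :
    (czGate u v)ᴴ = czGate u v := by
  simp only [czGate, Matrix.conjTranspose_smul, Matrix.conjTranspose_sub,
    Matrix.conjTranspose_add, Matrix.conjTranspose_one, Matrix.conjTranspose_mul, hu, hv, ← huv]
  congr 1
  simp

theorem isClifford_czGate {u v : Op κ} (hu : IsHermitianPauli u) (hv : IsHermitianPauli v)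
    (huv : u * v = v * u) : IsClifford (czGate u v) := by
  have hc := czGate_conjTranspose hu.conjTranspose_eq hv.conjTranspose_eq huv
  have h2 := czGate_mul_self hu.mul_self hv.mul_self huv
  refine ⟨Matrix.mem_unitaryGroup_iff.2 ?_, fun Q hQ => ?_⟩
  · rw [Matrix.star_eq_conjTranspose, hc, h2]
  · rw [hc]
    rcases hQ.commute_or_anticommute hu.isPauli with h1 | h1 <;>
      rcases hQ.commute_or_anticommute hv.isPauli with h2 | h2
    · rw [czGate_conj_of_commute hu.mul_self hv.mul_self huv h1 h2]
      exact hQ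
    · rw [czGate_conj_of_anticommute_right hu.mul_self hv.mul_self huv h1 h2]
      exact hu.isPauli.mul hQ
    · rw [czGate_conj_of_anticommute_left hu.mul_self hv.mul_self huv h1 h2]
      exact hv.isPauli.mul hQ
    · rw [czGate_conj_of_anticommute_both hu.mul_self hv.mul_self huv h1 h2]
      exact ((hu.isPauli.mul hv.isPauli).mul hQ).neg

/-! ### Extraction from reducible logical operators -/

theorem localHom_injective (S : Finset κ) : Function.Injective (localHom S) :=
  (localHom S).toRingHom.injective

theorem kron_add_left (M M' : Op κ) (N : Matrix (Fin 2) (Fin 2) ℂ) :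
    kron (M + M') N = kron M N + kron M' N := by
  ext; simp [kron, add_mul]

theorem kron_smul_left (c : ℂ) (M : Op κ) (N : Matrix (Fin 2) (Fin 2) ℂ) :
    kron (c • M) N = c • kron M N := by
  ext; simp [kron, mul_assoc]

theorem kron_add_right (M : Op κ) (N N' : Matrix (Fin 2) (Fin 2) ℂ) :
    kron M (N + N') = kron M N + kron M N' := by
  ext; simp [kron, mul_add]

theorem kron_smul_right (c : ℂ) (M : Op κ) (N : Matrix (Fin 2) (Fin 2) ℂ) :
    kron M (c • N) = c • kron M N := by
  ext; simp [kron, mul_left_comm]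

theorem kron_neg_left (M : Op κ) (N : Matrix (Fin 2) (Fin 2) ℂ) :
    kron (-M) N = -kron M N := by
  ext; simp [kron]

theorem kron_neg_right (M : Op κ) (N : Matrix (Fin 2) (Fin 2) ℂ) :
    kron M (-N) = -kron M N := by
  ext; simp [kron]

/-- This makes the gate built from a ⊗ X and b ⊗ Y a local operator on `A` and the ancilla. -/
theorem IsPauliSupportedOn.exists_localOp_eq_kron {A : Finset κ} {M : Op κ}
    (hM : IsPauliSupportedOn A M) (hH : Mᴴ = M) (a : Fin 4) :
    ∃ M' : Op (Finset.insertNone A), IsHermitianPauli M' ∧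
      localOp (Finset.insertNone A) M' = kron M (pauliMat a) := by
  obtain ⟨k, p, hp, rfl⟩ := hM
  have hP : IsPauli (Complex.I ^ k • pauliString p) := ⟨k, p, rfl⟩
  obtain ⟨r, hr⟩ := hP.isHermitianPauli hH
  have hpr : r = p := by
    rcases hr with h | h
    · exact eq_of_pauliString_eq_smul h.symm
    · refine eq_of_pauliString_eq_smul (c := -Complex.I ^ k) ?_
      rw [neg_smul, h, neg_neg]
  subst hpr
  have hext : extString A (fun i : A => r i) = r := by
    funext i
    by_cases hi : i ∈ A
    · simp [extString, hi]
    · simp [extString, hi, hp i hi]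
  have hq := pauliString_extString_insertNone A (fun i : A => r i) a
  rw [hext, ← localOp_pauliString] at hq
  rcases hr with h | h
  · exact ⟨_, ⟨_, Or.inl rfl⟩, by rw [hq, h]⟩
  · refine ⟨-pauliString ((insertNoneFunEquiv A).symm (fun i : A => r i, a)),
      ⟨_, Or.inr rfl⟩, ?_⟩
    rw [← localHom_apply, map_neg, localHom_apply, hq, h, kron_neg_left]

theorem pauliMat_one_mul_two : pauliMat 1 * pauliMat 2 = Complex.I • pauliMat 3 := by
  ext i j; fin_cases i <;> fin_cases j <;>
    simp [pauliMat, Matrix.mul_apply, Fin.sum_univ_two]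

theorem pauliMat_two_mul_one : pauliMat 2 * pauliMat 1 = -(Complex.I • pauliMat 3) := by
  ext i j; fin_cases i <;> fin_cases j <;>
    simp [pauliMat, Matrix.mul_apply, Fin.sum_univ_two]

theorem pauliMat_three_mul_one : pauliMat 3 * pauliMat 1 = -(pauliMat 1 * pauliMat 3) := by
  ext i j; fin_cases i <;> fin_cases j <;>
    simp [pauliMat, Matrix.mul_apply, Fin.sum_univ_two]

theorem pauliMat_three_mul_two : pauliMat 3 * pauliMat 2 = -(pauliMat 2 * pauliMat 3) := by
  ext i j; fin_cases i <;> fin_cases j <;>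
    simp [pauliMat, Matrix.mul_apply, Fin.sum_univ_two]

theorem vecMulVec_ketZero :
    Matrix.vecMulVec ketZero (star ketZero) = (1 / 2 : ℂ) • (1 + pauliMat 3) := by
  ext i j; fin_cases i <;> fin_cases j <;> simp [Matrix.vecMulVec_apply, ketZero, pauliMat]
  norm_num

theorem star_ketZero_dotProduct : star ketZero ⬝ᵥ ketZero = 1 := by
  simp [ketZero, dotProduct, Fin.sum_univ_two]

theorem star_ketT_dotProduct : star ketT ⬝ᵥ ketT = 1 := by
  have h := congrArg Matrix.trace vecMulVec_ketT
  rw [Matrix.trace_vecMulVec, dotProduct_comm] at h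
  rw [h, Matrix.trace_smul, Matrix.trace_add, Matrix.trace_smul, Matrix.trace_add,
    trace_pauliMat, trace_pauliMat, Matrix.trace_one]
  simp

theorem isStabilizerState_of_density_eq {φ : (κ → Fin 2) → ℂ} (hφ : star φ ⬝ᵥ φ = 1) {n : ℕ}
    (hn : n = Fintype.card κ) (s : Fin n → Op κ) (hs : ∀ j, IsHermitianPauli (s j))
    (hc : ∀ i j, Commute (s i) (s j)) (hd : density φ = ((2 : ℂ) ^ n)⁻¹ • stabProd s) :
    IsStabilizerState φ := by
  subst hn
  exact ⟨hφ, s, hs, hc, hd⟩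

theorem stabProd_cons {m : ℕ} (c : Op κ) (g : Fin m → Op κ) :
    stabProd (Fin.cons c g : Fin (m + 1) → Op κ) = (1 + c) * stabProd g := by
  simp [stabProd, List.ofFn_succ]

theorem op_eq_zero_of_eq_neg {M : Op κ} (h : M = -M) : M = 0 := by
  have h2 : (2 : ℂ) • M = 0 := by
    rw [two_smul]
    nth_rewrite 1 [h]
    exact neg_add_cancel M
  exact (smul_eq_zero.1 h2).resolve_left two_ne_zero

/-- On no qubits all Hermitian Paulis are ±1 and cannot anticommute. Hence the truncated `L - 1` is
one less than `L`, leaving room for exactly one more generator. -/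
theorem Code.pos {L : ℕ} (K : Code L) : L ≠ 0 := by
  rintro rfl
  have hp : ∀ p : Fin 0 → Fin 4, pauliString p = 1 := fun p => by
    rw [Subsingleton.elim p 0, pauliString_zero]
  have hne : K.logZ ≠ 0 := fun h => by
    have := K.logZ_pauli.mul_self
    rw [h, mul_zero] at this
    exact zero_ne_one this
  have h := K.anticomm
  obtain ⟨p, hX | hX⟩ := K.logX_pauli <;> rw [hX, hp] at h
  · rw [one_mul, mul_one] at h
    exact hne (op_eq_zero_of_eq_neg h)
  · rw [neg_mul, mul_neg, one_mul, mul_one, neg_neg] at h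
    exact hne (op_eq_zero_of_eq_neg h.symm)

/-- The register factor is the contraction of `w` with ⟨χ| on the ancilla. -/
theorem eq_withAncilla_of_fixed {L : ℕ} {w : (Option (Fin L) → Fin 2) → ℂ} {χ : Fin 2 → ℂ}
    (h : kron 1 (Matrix.vecMulVec χ (star χ)) *ᵥ w = w) :
    ∃ φ : (Fin L → Fin 2) → ℂ, w = withAncilla φ χ := by
  refine ⟨fun x => ∑ b, star (χ b) * w ((Equiv.piOptionEquivProd).symm (b, x)), ?_⟩
  funext x
  conv_lhs => rw [← h]
  simp only [Matrix.mulVec, dotProduct, sum_option_fun, kron, Matrix.of_apply,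
    Equiv.piOptionEquivProd, Equiv.coe_fn_symm_mk, withAncilla, Matrix.one_apply,
    Matrix.vecMulVec_apply, Pi.star_apply, ite_mul, one_mul, zero_mul, Finset.sum_mul]
  refine Finset.sum_congr rfl fun b _ => ?_
  rw [Finset.sum_eq_single fun i => x (some i)]
  · refine (if_pos rfl).trans ?_
    ring
  · intro y _ hy
    exact if_neg (Ne.symm hy)
  · simp

theorem kron_left_injective {M M' : Op κ} {N : Matrix (Fin 2) (Fin 2) ℂ} (hN : N 0 0 ≠ 0)
    (h : kron M N = kron M' N) : M = M' := by
  ext x y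
  have := congrFun (congrFun h (fun i => i.elim 0 x)) (fun i => i.elim 0 y)
  exact mul_right_cancel₀ hN this

theorem Code.IsOneUnitState.unitarilyExtractable {L : ℕ} {K : Code L}
    {ψ : (Fin L → Fin 2) → ℂ} (hψ : K.IsOneUnitState ψ) {A : Finset (Fin L)}
    (hY : K.Reducible A K.logY) (hZ : K.Reducible A K.logZ) : UnitarilyExtractable A ψ := by
  obtain ⟨s, hs, hsA⟩ := hZ
  obtain ⟨t, ht, htA⟩ := hY
  have cZs := K.commute_of_mem_stabGroup K.logZ_commute hs
  have cZt := K.commute_of_mem_stabGroup K.logZ_commute ht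
  have cYs := K.commute_of_mem_stabGroup K.logY_commute hs
  have cYt := K.commute_of_mem_stabGroup K.logY_commute ht
  have cst := K.mem_stabGroup_comm hs ht
  set a : Op (Fin L) := K.logZ * s with ha
  -- The sign turns Z̄ - Ȳ into a + b on the code space, to match X + Y in the projector on |T⟩.
  set b : Op (Fin L) := -(K.logY * t) with hb
  have hbA : IsPauliSupportedOn A b := by
    obtain ⟨k, p, hp, h⟩ := htA
    exact ⟨2 + k, p, hp, by rw [hb, h, pow_add, Complex.I_sq, neg_one_mul, neg_smul]⟩
  have haH : aᴴ = a := by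
    rw [ha, Matrix.conjTranspose_mul, K.mem_stabGroup_conjTranspose hs,
      K.logZ_pauli.conjTranspose_eq, cZs.eq]
  have hbH : bᴴ = b := by
    rw [hb, Matrix.conjTranspose_neg, Matrix.conjTranspose_mul, K.mem_stabGroup_conjTranspose ht,
      K.logY_conjTranspose, cYt.eq]
  have haP : IsPauli a := K.logZ_pauli.isPauli.mul (K.mem_stabGroup_isPauli hs)
  have hbP : IsPauli b := (K.logY_pauli.isPauli.mul (K.mem_stabGroup_isPauli ht)).neg
  have haa := haP.mul_self haH
  have hbb := hbP.mul_self hbH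
  have hab : a * b = -(b * a) := by
    have h1 : a * b = -(K.logZ * K.logY * (s * t)) := by
      rw [ha, hb, mul_neg, mul_assoc, ← mul_assoc s, ← cYs.eq, mul_assoc, mul_assoc]
    have h2 : b * a = -(K.logY * K.logZ * (s * t)) := by
      rw [ha, hb, neg_mul, mul_assoc, ← mul_assoc t, ← cZt.eq, mul_assoc, mul_assoc, cst.eq]
    rw [h1, h2, K.logZ_logY_anticomm, neg_mul]
  have hba : b * a = -(a * b) := by rw [hab, neg_neg]
  have hap : a * stabProd K.gen = K.logZ * stabProd K.gen := by
    rw [ha, mul_assoc, K.mem_stabGroup_mul_stabProd hs]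
  have hbp : b * stabProd K.gen = -(K.logY * stabProd K.gen) := by
    rw [hb, neg_mul, mul_assoc, K.mem_stabGroup_mul_stabProd ht]
  have hag : ∀ j, Commute a (K.gen j) := fun j =>
    (K.logZ_commute j).mul_left
      (K.commute_of_mem_stabGroup (fun i => K.gen_commute j i) hs).symm
  have hbg : ∀ j, Commute b (K.gen j) := fun j =>
    ((K.logY_commute j).mul_left
      (K.commute_of_mem_stabGroup (fun i => K.gen_commute j i) ht).symm).neg_left
  obtain ⟨u', hu', hu⟩ := hsA.exists_localOp_eq_kron haH 1
  obtain ⟨v', hv', hv⟩ := hbA.exists_localOp_eq_kron hbH 2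
  set u := kron a (pauliMat 1) with hudef
  set v := kron b (pauliMat 2) with hvdef
  have huu : u * u = 1 := by
    rw [hudef, kron_mul, haa, pauliMat_mul_self, kron_one_one]
  have hvv : v * v = 1 := by
    rw [hvdef, kron_mul, hbb, pauliMat_mul_self, kron_one_one]
  -- The signs from ab = -ba and XY = -YX cancel.
  have huv : u * v = v * u := by
    rw [hudef, hvdef, kron_mul, kron_mul, hab, pauliMat_one_mul_two, pauliMat_two_mul_one,
      kron_neg_left, kron_neg_right]
  have huv' : u' * v' = v' * u' := by
    apply localHom_injective
    rw [map_mul, map_mul, localHom_apply, localHom_apply, hu, hv, huv]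
  set U := czGate u' v' with hU
  set V := localOp (Finset.insertNone A) U with hVdef
  have hV : V = czGate u v := by
    rw [hVdef, hU, ← localHom_apply, map_czGate, localHom_apply, localHom_apply, hu, hv]
  have hVV : V * V = 1 := by rw [hV, czGate_mul_self huu hvv huv]
  have hVH : Vᴴ = V := by
    rw [hVdef, ← localOp_conjTranspose, hU,
      czGate_conjTranspose hu'.conjTranspose_eq hv'.conjTranspose_eq huv']
  have Va : V * kron a 1 * V = kron 1 (pauliMat 1) := by
    rw [hV, czGate_conj_of_anticommute_right huu hvv huv]
    · rw [hudef, kron_mul, haa, mul_one]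
    · rw [hudef, kron_mul, kron_mul, one_mul, mul_one]
    · rw [hvdef, kron_mul, kron_mul, one_mul, mul_one, hab, kron_neg_left]
  have Vb : V * kron b 1 * V = kron 1 (pauliMat 2) := by
    rw [hV, czGate_conj_of_anticommute_left huu hvv huv]
    · rw [hvdef, kron_mul, hbb, mul_one]
    · rw [hudef, kron_mul, kron_mul, one_mul, mul_one, hba, kron_neg_left]
    · rw [hvdef, kron_mul, kron_mul, one_mul, mul_one]
  -- The image of the ancilla's Z, which anticommutes with both u and v, is -uv(1 ⊗ Z); here XY·Z =
  -- i, leaving -i ab on the register.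
  set c : Op (Fin L) := -(Complex.I • (a * b)) with hc
  have Vz : V * kron 1 (pauliMat 3) * V = kron c 1 := by
    rw [hV, czGate_conj_of_anticommute_both huu hvv huv]
    · rw [hudef, hvdef, kron_mul, kron_mul, mul_one, pauliMat_one_mul_two, smul_mul_assoc,
        pauliMat_mul_self, kron_smul_right, hc, kron_neg_left, kron_smul_left]
    · rw [hudef, kron_mul, kron_mul, one_mul, mul_one, pauliMat_three_mul_one, kron_neg_right]
    · rw [hvdef, kron_mul, kron_mul, one_mul, mul_one, pauliMat_three_mul_two, kron_neg_right]
  have Vp : V * kron (stabProd K.gen) 1 * V = kron (stabProd K.gen) 1 := by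
    rw [hV, czGate_conj_of_commute huu hvv huv]
    · rw [hudef, kron_mul, kron_mul, one_mul, mul_one, (commute_stabProd hag).eq]
    · rw [hvdef, kron_mul, kron_mul, one_mul, mul_one, (commute_stabProd hbg).eq]
  have hconj : ∀ M N, V * (M * N) * V = V * M * V * (V * N * V) := fun M N => by
    rw [mul_assoc (V * M), mul_assoc V N, ← mul_assoc V V, hVV, one_mul]
    simp only [mul_assoc]
  set r : ℂ := ((Real.sqrt 2 : ℝ) : ℂ)⁻¹ with hr
  set w := V *ᵥ withAncilla ψ ketZero with hw
  have hw1 : star w ⬝ᵥ w = 1 := by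
    have := expVal_conj_mulVec (withAncilla ψ ketZero) V 1
    rw [expVal_one, mul_one, hVH, hVV, expVal_one, star_withAncilla_dotProduct, hψ.1,
      star_ketZero_dotProduct, one_mul] at this
    exact this
  have hcg : ∀ j, Commute c (K.gen j) := fun j =>
    (((hag j).mul_left (hbg j)).smul_left _).neg_left
  have hdw : density w = kron (((2 : ℂ) ^ L)⁻¹ • ((1 + c) * stabProd K.gen))
      (Matrix.vecMulVec ketT (star ketT)) := by
    have h0 : density w = V * density (withAncilla ψ ketZero) * V := by
      nth_rewrite 2 [← hVH]
      rw [hw, density, density, Matrix.mul_vecMulVec, Matrix.vecMulVec_mul, Matrix.star_mulVec]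
    have h1 : density ψ = ((2 : ℂ) ^ L)⁻¹ • ((1 + r • (a + b)) * stabProd K.gen) := by
      rw [hψ.density_eq, logW]
      simp only [add_mul, smul_mul_assoc, hap, hbp, sub_eq_add_neg, ← hr]
      simp only [neg_mul]
    have h2 : kron (density ψ) (Matrix.vecMulVec ketZero (star ketZero)) =
        (((2 : ℂ) ^ L)⁻¹ * (1 / 2)) • ((1 + r • (kron a 1 + kron b 1)) *
          kron (stabProd K.gen) 1 * (1 + kron 1 (pauliMat 3))) := by
      rw [h1, vecMulVec_ketZero, kron_smul_left, kron_smul_right, smul_smul]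
      rw [← kron_add_left, ← kron_smul_left r, ← kron_one_one, ← kron_add_left, ← kron_add_right,
        kron_mul, kron_mul, one_mul, one_mul, mul_one]
    rw [h0, density_withAncilla, h2, mul_smul_comm, smul_mul_assoc, hconj, hconj, Vp]
    have e1 : V * (1 + r • (kron a 1 + kron b 1)) * V =
        1 + r • (kron 1 (pauliMat 1) + kron 1 (pauliMat 2)) := by
      simp only [mul_add, add_mul, mul_one, hVV, mul_smul_comm, smul_mul_assoc, Va, Vb]
    have e2 : V * (1 + kron 1 (pauliMat 3)) * V = 1 + kron c 1 := by
      simp only [mul_add, add_mul, mul_one, hVV, Vz]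
    rw [e1, e2, vecMulVec_ketT, kron_smul_left, kron_smul_right, smul_smul]
    have hcp : Commute (1 + c) (stabProd K.gen) :=
      (Commute.one_left _).add_left (commute_stabProd hcg)
    rw [hcp.eq, ← kron_add_right, ← kron_smul_right, ← kron_one_one, ← kron_add_left,
      ← kron_add_right, kron_mul, kron_mul, one_mul, mul_one, mul_one]
  have hTT : Matrix.vecMulVec ketT (star ketT) * Matrix.vecMulVec ketT (star ketT) =
      Matrix.vecMulVec ketT (star ketT) := by
    rw [Matrix.vecMulVec_mul_vecMulVec, star_ketT_dotProduct, one_smul]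
  obtain ⟨φ, hφ⟩ : ∃ φ : (Fin L → Fin 2) → ℂ, w = withAncilla φ ketT := by
    refine eq_withAncilla_of_fixed (mulVec_eq_of_mul_density hw1 ?_)
    rw [hdw, kron_mul, one_mul, hTT]
  have hφ1 : star φ ⬝ᵥ φ = 1 := by
    rwa [hφ, star_withAncilla_dotProduct, star_ketT_dotProduct, mul_one] at hw1
  refine ⟨U, isClifford_czGate hu' hv' huv', φ, ?_, hφ⟩
  rw [hφ, density_withAncilla] at hdw
  -- The ancilla factor cancels because the (0,0) entry of |T⟩⟨T| is 1/2.
  have hdφ := kron_left_injective (by rw [vecMulVec_ketT]; simp [pauliMat]) hdw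
  have hcH : IsHermitianPauli c := by
    refine IsPauli.isHermitianPauli ?_ ?_
    · have := ((haP.mul hbP).I_pow_smul 1).neg
      rwa [pow_one] at this
    · rw [hc, Matrix.conjTranspose_neg, Matrix.conjTranspose_smul, Matrix.conjTranspose_mul, haH,
        hbH, hba]
      simp
  have hL : L - 1 + 1 = L := Nat.sub_add_cancel (Nat.one_le_iff_ne_zero.2 K.pos)
  refine isStabilizerState_of_density_eq hφ1 (n := L - 1 + 1) (by rw [hL, Fintype.card_fin])
    (Fin.cons c K.gen) ?_ ?_ ?_
  · intro j
    refine Fin.cases ?_ (fun i => ?_) j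
    · exact hcH
    · exact K.gen_pauli i
  · intro i j
    refine Fin.cases ?_ (fun i => ?_) i <;> refine Fin.cases ?_ (fun j => ?_) j
    · exact Commute.refl _
    · exact hcg j
    · exact (hcg i).symm
    · exact K.gen_commute i j
  · rw [stabProd_cons, hL, hdφ]

end QubitMagic

end

theorem mainTheorem3 (L : ℕ) (K : QubitMagic.Code L) (ψ : (Fin L → Fin 2) → ℂ)
    (hψ : K.IsOneUnitState ψ) (A : Finset (Fin L)) :
    List.TFAE
      [QubitMagic.stabilizerEntropy (QubitMagic.reduced A (QubitMagic.density ψ)) =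
          Real.logb 2 (4 / 3),
        K.Reducible A K.logX ∧ K.Reducible A K.logY ∧ K.Reducible A K.logZ,
        QubitMagic.UnitarilyExtractable A ψ] := by
  tfae_have 1 → 2 := QubitMagic.Code.reducible_of_stabilizerEntropy hψ
  tfae_have 2 → 3 := fun h => hψ.unitarilyExtractable h.2.1 h.2.2
  tfae_have 3 → 1 := QubitMagic.UnitarilyExtractable.stabilizerEntropy_eq hψ.1
  tfae_finish
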